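/- Let $d\ge 1$ be an integer and $r=(r_1,\dots,r_d)\in\mathbb N^d$ (with $0\in\mathbb N$). For $0<p\le\infty$ let $L_p([0,1]^d)$ be the usual space of real measurable functions on $[0,1]^d$ with finite (quasi-)norm $\|\cdot\|_p$ for Lebesgue measure ($\|\cdot\|_\infty$ is the essential supremum). A dyadic rectangle of $[0,1]^d$ is a product $I_1\times\dots\times I_d$ where each $I_l$ is $[0,2^{-j_l}]$ or $(k_l2^{-j_l},(k_l+1)2^{-j_l}]$ with $j_l\in\mathbb N$ and $k_l\in\{1,\dots,2^{j_l}-1\}$. For a partition $m$ of $[0,1]^d$ into finitely many dyadic rectangles, $|m|$ is the number of rectangles and $S_{(m,r)}$ is the space of functions on $[0,1]^d$ that coincide on each rectangle of $m$ with a polynomial of degree $\le r_l$ in the $l$-th variable for every $l$. For $\sigma=(\sigma_1,\dots,\sigma_d)\in\prod_{l=1}^d(0,r_l+1)$ set $\underline\sigma=\min_l\sigma_l$ and $H(\sigma)=\bigl(\frac1d\sum_{l=1}^d\frac1{\sigma_l}\bigr)^{-1}$. For $k\in\mathbb N$ let $\mathcal D_k^\sigma$ be the partition of $[0,1]^d$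 into the dyadic rectangles with $j_l=\lfloor k\underline\sigma/\sigma_l\rfloor$ for every $l$. For $s\in L_p([0,1]^d)$ and $0<p'\le\infty$ put $e_{k}(s)=\inf_{P\in S_{(\mathcal D_k^\sigma,r)}}\|s-P\|_p$ and $$N_{r,\sigma,p,p'}(s)=\Bigl(\sum_{k\in\mathbb N}\bigl(2^{k\underline\sigma}e_{k}(s)\bigr)^{p'}\Bigr)^{1/p'}\ (p'<\infty),\qquad N_{r,\sigma,p,\infty}(s)=\sup_{k\in\mathbb N}2^{k\underline\sigma}e_{k}(s).$$ **Theorem.** Let $R>0$, $\sigma\in\prod_{l=1}^d(0,r_l+1)$, $0<p<\infty$ and $1\le q\le\infty$ be such that $H(\sigma)/d>(1/p-1/q)_+$, where $x_+=\max\{x,0\}$. Let $p'=\infty$ if $0<p\le1$ or $p\ge q$, and $p'=p$ if $1<p<q$. Assume that $s\in L_p([0,1]^d)$ and $N_{r,\sigma,p,p'}(s)\le R$. Then for every $k\in\mathbb N$ there is a partition $m$ of $[0,1]^d$ into dyadic rectangles, which may depend on $s,d,r,\sigma,p,q,k$ but not on $R$, such that $$|m|\le C_1\,2^{kd}\qquad\text{and}\qquad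 \inf_{t\in S_{(m,r)}}\|s-t\|_q\le C_2\,R\,2^{-kH(\sigma)},$$ where $C_1>0$ depends only on $d,\sigma,p$ and $C_2>0$ depends only on $d,r,\sigma,p,q$. -/

import Mathlib

open MeasureTheory Set
open scoped ENNReal

noncomputable section

namespace DyadicApprox

/-- The unit cube `[0,1]^d`. -/
def cube (d : ℕ) : Set (Fin d → ℝ) := Icc 0 1

/-- Lebesgue measure on the unit cube. -/
def cubeMeasure (d : ℕ) : Measure (Fin d → ℝ) := volume.restrict (cube d)

/-- The `k`-th dyadic interval of length `2^{-j}`: the interval `[0, 2^{-j}]` for `k = 0`,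
and `]k 2^{-j}, (k+1) 2^{-j}]` for `k ≥ 1`. -/
def dyadicInterval (j k : ℕ) : Set ℝ :=
  if k = 0 then Icc 0 ((2 : ℝ) ^ j)⁻¹
  else Ioc ((k : ℝ) * ((2 : ℝ) ^ j)⁻¹) (((k : ℝ) + 1) * ((2 : ℝ) ^ j)⁻¹)

/-- The product of the dyadic intervals of levels `j l` and positions `k l`. -/
def dyadicRectangle {d : ℕ} (j k : Fin d → ℕ) : Set (Fin d → ℝ) :=
  Set.pi univ fun l => dyadicInterval (j l) (k l)

/-- `K` is a dyadic rectangle of `[0,1]^d`. -/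
def IsDyadicRectangle {d : ℕ} (K : Set (Fin d → ℝ)) : Prop :=
  ∃ j k : Fin d → ℕ, (∀ l, k l < 2 ^ j l) ∧ K = dyadicRectangle j k

/-- The smallest coordinate of `σ` (for `d ≥ 1`). -/
def minSmoothness {d : ℕ} (σ : Fin d → ℝ) : ℝ := ⨅ l, σ l

/-- The harmonic mean `H(σ)` of the coordinates of `σ`. -/
def harmonicMean {d : ℕ} (σ : Fin d → ℝ) : ℝ := ((1 / (d : ℝ)) * ∑ l, 1 / σ l)⁻¹

/-- The dyadic level `⌊j min(σ) / σ_l⌋` used in direction `l` at step `j`. -/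
def gridLevel {d : ℕ} (σ : Fin d → ℝ) (j : ℕ) (l : Fin d) : ℕ :=
  ⌊(j : ℝ) * minSmoothness σ / σ l⌋₊

/-- The collection of all dyadic rectangles of `[0,1]^d` whose `l`-th side has length
`2^{-⌊j min(σ) / σ_l⌋}` for every direction `l`. -/
def anisotropicGrid {d : ℕ} (σ : Fin d → ℝ) (j : ℕ) : Set (Set (Fin d → ℝ)) :=
  {K | ∃ k : Fin d → ℕ, (∀ l, k l < 2 ^ gridLevel σ j l) ∧
    K = dyadicRectangle (gridLevel σ j) k}

/-- The functions that coincide, on each set of the collection `𝒦`, with a polynomial of degree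
at most `r l` in the `l`-th direction. -/
def piecewisePoly {d : ℕ} (r : Fin d → ℕ) (𝒦 : Set (Set (Fin d → ℝ))) :
    Set ((Fin d → ℝ) → ℝ) :=
  {t | ∀ K ∈ 𝒦, ∃ P : MvPolynomial (Fin d) ℝ,
    (∀ l, P.degreeOf l ≤ r l) ∧ ∀ x ∈ K, t x = MvPolynomial.eval x P}

/-- The error of best approximation of `s` by elements of `T`, in the `L_p` (quasi-)norm
on `[0,1]^d`. -/
def approxError {d : ℕ} (p : ℝ≥0∞) (s : (Fin d → ℝ) → ℝ) (T : Set ((Fin d → ℝ) → ℝ)) : ℝ≥0∞ :=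
  ⨅ t ∈ T, eLpNorm (s - t) p (cubeMeasure d)

/-- The error of best `L_p` approximation of `s` by piecewise polynomials on the `k`-th
anisotropic grid. -/
def gridError {d : ℕ} (r : Fin d → ℕ) (σ : Fin d → ℝ) (p : ℝ≥0∞) (k : ℕ)
    (s : (Fin d → ℝ) → ℝ) : ℝ≥0∞ :=
  approxError p s (piecewisePoly r (anisotropicGrid σ k))

/-- The anisotropic dyadic smoothness (quasi-)semi-norm `N_{r,σ,p,p'}(s)`, for `0 < p' ≤ ∞`. -/
def smoothnessNorm {d : ℕ} (r : Fin d → ℕ) (σ : Fin d → ℝ) (p p' : ℝ≥0∞)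
    (s : (Fin d → ℝ) → ℝ) : ℝ≥0∞ :=
  if p' = ∞ then
    ⨆ k : ℕ, (2 : ℝ≥0∞) ^ ((k : ℝ) * minSmoothness σ) * gridError r σ p k s
  else
    (∑' k : ℕ, ((2 : ℝ≥0∞) ^ ((k : ℝ) * minSmoothness σ) * gridError r σ p k s) ^ p'.toReal)
      ^ (1 / p'.toReal)

/-- The class of all `s` in `L_p([0,1]^d)` such that `N_{r,σ,p,p'}(s) ≤ R`. -/
def smoothnessClass {d : ℕ} (r : Fin d → ℕ) (σ : Fin d → ℝ) (p p' : ℝ≥0∞) (R : ℝ) :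
    Set ((Fin d → ℝ) → ℝ) :=
  {s | MemLp s p (cubeMeasure d) ∧ smoothnessNorm r σ p p' s ≤ ENNReal.ofReal R}

end DyadicApprox

end

/-!
Throughout, the third index `p'` plays no role: the norm with index `∞` is the weakest, and it
already gives the rate. Write `μ = min σ`, `β = μ ∑ 1 / σ_l` (`gridRate`), so that the `j`-th grid
has at most `2^(jβ)` cells and `H(σ) = dμ / β`. It is enough to find, for every level `J`, a
partition with `O(2^(Jβ))` cells and error `O(R 2^(-Jμ))`; the level is then chosen with
`Jβ ≈ kd`. For `q ≤ p` the `J`-th grid itself is such a partition, as the cube has measure one.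

For `p < q`, let `P j` be near-best `L_p` approximants on the grids, and `Δ i` the increment
`P (J + i + 1) - P (J + i)`, of `L_p` norm `E i = O(R 2^(-(J + i)μ))`. A cell of level `J + i` is
marked if `|Δ i|` exceeds a threshold `v i` somewhere on it; marked cells and their ancestors are
subdivided. The partition consists of the cells at which this process stops, and the approximant is
`P j` on the cells of level `j`.

* Number of cells. The sup norm of a polynomial on a cell is controlled by its `L_p` mean
  (`enorm_eval_rpow_le_setLIntegral_pi`), which gives a weak-type bound for the number of marked
  cells (`card_mul_rpow_le_eLpNorm_rpow`). A marked cell forces at most `i + 1` subdivisions, each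
  of them producing at most `2^d` cells (`exists_finset_stopLevel_card_le`).
* Error. Where the process has stopped, `|Δ i| ≤ v i`. The error is thus dominated by the sum of
  the truncations `min |Δ i| (v i)`, whose `L_q` norms are at most `(v i)^(1 - p/q) (E i)^(p/q)`
  (`exists_finpartition_of_thresholds`).

The assumption `β (1/p - 1/q) < μ` leaves room to choose thresholds for which the numbers of marked
cells and the errors both decay geometrically in `i` (`exists_finpartition_approxError_le`). They
depend on the bound `R`, so the partition is built for `R` equal to the norm of `s`. If that norm
vanishes, `s` is an `L_p` limit of piecewise polynomials on each grid, hence an `L_q` limit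
(`approxError_eq_zero_of_approxError_eq_zero`), and the grid can be used again.
-/

namespace DyadicApprox

/-! ### Sup bounds for polynomials -/

/-- Separation of the interpolation nodes bounds the Lagrange basis polynomials on the interval. -/
lemma abs_eval_lagrangeBasis_le {n : ℕ} {y : Fin (n + 1) → ℝ} {x h δ : ℝ} (hδ : 0 < δ)
    (hδh : δ ≤ h) (hsep : ∀ i j, i ≠ j → δ ≤ |y i - y j|) (hx : ∀ i, |x - y i| ≤ h)
    (i : Fin (n + 1)) :
    |(Lagrange.basis Finset.univ y i).eval x| ≤ (h / δ) ^ n := by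
  have hratio : ∀ j ∈ Finset.univ.erase i,
      |(Lagrange.basisDivisor (y i) (y j)).eval x| ≤ h / δ := by
    intro j hj
    have hij := hsep i j (Finset.ne_of_mem_erase hj).symm
    simp only [Lagrange.basisDivisor, Polynomial.eval_mul, Polynomial.eval_C,
      Polynomial.eval_sub, Polynomial.eval_X, abs_mul, abs_inv]
    rw [mul_comm, ← div_eq_mul_inv]
    exact div_le_div₀ (hδ.le.trans hδh) (hx j) hδ hij
  rw [Lagrange.basis, Polynomial.eval_prod, Finset.abs_prod]
  refine (Finset.prod_le_prod (fun _ _ => abs_nonneg _) hratio).trans ?_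
  simp [div_pow]

/-- A polynomial is bounded on an interval by its largest value at well separated nodes. -/
lemma exists_abs_eval_le_of_separated {n : ℕ} (f : Polynomial ℝ) (hf : f.natDegree ≤ n)
    {y : Fin (n + 1) → ℝ} {x h δ : ℝ} (hδ : 0 < δ) (hδh : δ ≤ h)
    (hsep : ∀ i j, i ≠ j → δ ≤ |y i - y j|) (hx : ∀ i, |x - y i| ≤ h) :
    ∃ i, |f.eval x| ≤ (n + 1) * (h / δ) ^ n * |f.eval (y i)| := by
  obtain ⟨i, -, hi⟩ := Finset.exists_max_image Finset.univ (fun i => |f.eval (y i)|)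
    Finset.univ_nonempty
  refine ⟨i, ?_⟩
  have hinj : Set.InjOn y (Finset.univ : Finset (Fin (n + 1))) := by
    intro a _ b _ hab
    by_contra hne
    have := hsep a b hne
    rw [hab, sub_self, abs_zero] at this
    linarith
  have hdeg : f.degree < (Finset.univ : Finset (Fin (n + 1))).card := by
    rw [Finset.card_fin]
    exact (Polynomial.natDegree_le_iff_degree_le.1 hf).trans_lt (by exact_mod_cast n.lt_succ_self)
  have hfx : f.eval x = ∑ j, f.eval (y j) * (Lagrange.basis Finset.univ y j).eval x := by
    conv_lhs => rw [Lagrange.eq_interpolate hinj hdeg]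
    simp [Lagrange.interpolate_apply, Polynomial.eval_finsetSum]
  rw [hfx]
  calc |∑ j, f.eval (y j) * (Lagrange.basis Finset.univ y j).eval x|
      ≤ ∑ j, |f.eval (y j) * (Lagrange.basis Finset.univ y j).eval x| :=
        Finset.abs_sum_le_sum_abs _ _
    _ ≤ ∑ _j : Fin (n + 1), |f.eval (y i)| * (h / δ) ^ n := by
        refine Finset.sum_le_sum fun j hj => ?_
        rw [abs_mul]
        exact mul_le_mul (hi j hj) (abs_eval_lagrangeBasis_le hδ hδh hsep hx j)
          (abs_nonneg _) (abs_nonneg _)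
    _ = (n + 1) * (h / δ) ^ n * |f.eval (y i)| := by
        simp
        ring

/-- The constant in the sup bound for univariate polynomials of degree at most `n`. -/
noncomputable def supConst (n : ℕ) (a : ℝ) : ℝ :=
  ((n + 1) * (2 * n + 1) ^ n) ^ a * (2 * n + 1)

lemma supConst_pos (n : ℕ) (a : ℝ) : 0 < supConst n a := by
  unfold supConst
  positivity

/-- On an interval of length `h`, `|f|^a` is bounded by a constant times its mean value, for every
polynomial `f` of degree at most `n` and every exponent `a > 0`. The interval is cut into `2n+1`
equal pieces; on every second one, a node is chosen where `|f|^a` is at most its mean value. -/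
lemma enorm_eval_rpow_le_lintegral {n : ℕ} (f : Polynomial ℝ) (hf : f.natDegree ≤ n) {a : ℝ}
    (ha : 0 < a) {u h x : ℝ} (hh : 0 < h) (hx : x ∈ Icc u (u + h)) :
    ‖f.eval x‖ₑ ^ a ≤
      ENNReal.ofReal (supConst n a * h⁻¹) * ∫⁻ y in Ioc u (u + h), ‖f.eval y‖ₑ ^ a := by
  set δ : ℝ := h / (2 * n + 1) with hδ
  have hn : (0 : ℝ) < 2 * n + 1 := by positivity
  have hδ0 : 0 < δ := by positivity
  have hδh : (2 * n + 1) * δ = h := by rw [hδ]; field_simp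
  let T : Fin (n + 1) → Set ℝ := fun i => Ioc (u + 2 * i * δ) (u + (2 * i + 1) * δ)
  have hvol : ∀ i, volume (T i) = ENNReal.ofReal δ := by
    intro i
    rw [Real.volume_Ioc]
    congr 1
    ring
  have hmeas : Measurable fun y => ‖f.eval y‖ₑ ^ a :=
    (f.continuous.measurable.enorm).pow_const a
  have hnode : ∀ i, ∃ y ∈ T i, ‖f.eval y‖ₑ ^ a ≤ ⨍⁻ z in T i, ‖f.eval z‖ₑ ^ a ∂volume := by
    intro i
    refine exists_le_setLAverage ?_ ?_ hmeas.aemeasurable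
    · rw [hvol]; simpa using hδ0
    · rw [hvol]; exact ENNReal.ofReal_ne_top
  choose y hyT hy using hnode
  have hTsub : ∀ i, T i ⊆ Ioc u (u + h) := by
    intro i z hz
    have hi : ((i : ℕ) : ℝ) ≤ n := by exact_mod_cast Nat.lt_succ_iff.1 i.2
    have hi0 : (0 : ℝ) ≤ ((i : ℕ) : ℝ) := by positivity
    refine ⟨lt_of_le_of_lt ?_ hz.1, hz.2.trans ?_⟩
    · nlinarith
    · nlinarith
  have hsep : ∀ i j, i ≠ j → δ ≤ |y i - y j| := by
    have key : ∀ i j : Fin (n + 1), i < j → δ ≤ y j - y i := by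
      intro i j hij
      have h1 : ((i : ℕ) : ℝ) + 1 ≤ ((j : ℕ) : ℝ) := by exact_mod_cast hij
      have h2 := (hyT i).2
      have h3 := (hyT j).1
      nlinarith
    intro i j hij
    rcases lt_or_gt_of_ne hij with h1 | h1
    · rw [abs_sub_comm]; exact (key i j h1).trans (le_abs_self _)
    · exact (key j i h1).trans (le_abs_self _)
  have hxy : ∀ i, |x - y i| ≤ h := by
    intro i
    have := hTsub i (hyT i)
    rw [abs_le]
    constructor <;> linarith [hx.1, hx.2, this.1, this.2]
  obtain ⟨i, hi⟩ := exists_abs_eval_le_of_separated f hf hδ0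
    (by nlinarith [(Nat.cast_nonneg n : (0 : ℝ) ≤ n)]) hsep hxy
  have hhδ : h / δ = 2 * n + 1 := by rw [← hδh]; field_simp
  rw [hhδ] at hi
  set D : ℝ := (n + 1) * (2 * n + 1) ^ n with hD
  have hD0 : 0 ≤ D := by positivity
  have h1 : ‖f.eval x‖ₑ ≤ ENNReal.ofReal D * ‖f.eval (y i)‖ₑ := by
    rw [Real.enorm_eq_ofReal_abs, Real.enorm_eq_ofReal_abs, ← ENNReal.ofReal_mul hD0]
    exact ENNReal.ofReal_le_ofReal hi
  calc ‖f.eval x‖ₑ ^ a ≤ (ENNReal.ofReal D * ‖f.eval (y i)‖ₑ) ^ a :=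
        ENNReal.rpow_le_rpow h1 ha.le
    _ = ENNReal.ofReal (D ^ a) * ‖f.eval (y i)‖ₑ ^ a := by
        rw [ENNReal.mul_rpow_of_nonneg _ _ ha.le, ENNReal.ofReal_rpow_of_nonneg hD0 ha.le]
    _ ≤ ENNReal.ofReal (D ^ a) *
          (ENNReal.ofReal δ⁻¹ * ∫⁻ y in Ioc u (u + h), ‖f.eval y‖ₑ ^ a) := by
        gcongr
        refine (hy i).trans ?_
        rw [setLAverage_eq, hvol, ENNReal.ofReal_inv_of_pos hδ0, div_eq_mul_inv, mul_comm]
        gcongr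
        exact hTsub i
    _ = _ := by
        rw [← mul_assoc, ← ENNReal.ofReal_mul (by positivity), supConst, hδ, hD]
        congr 2
        field_simp

/-- Freezing all variables but one turns a multivariate polynomial into a univariate one. -/
lemma exists_polynomial_eval_update {ι : Type*} [Fintype ι] [DecidableEq ι]
    (P : MvPolynomial ι ℝ) (x : ι → ℝ) (l : ι) :
    ∃ f : Polynomial ℝ, f.natDegree ≤ P.degreeOf l ∧
      ∀ y, MvPolynomial.eval (Function.update x l y) P = f.eval y := by
  let g : ι → Polynomial ℝ := fun i => if i = l then Polynomial.X else Polynomial.C (x i)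
  refine ⟨MvPolynomial.aeval g P, ?_, fun y => ?_⟩
  · rw [MvPolynomial.aeval_def, MvPolynomial.eval₂_eq]
    refine Polynomial.natDegree_sum_le_of_forall_le _ _ fun m hm => ?_
    refine (Polynomial.natDegree_C_mul_le _ _).trans ?_
    refine (Polynomial.natDegree_prod_le _ _).trans ?_
    have h1 : ∀ i ∈ m.support, (g i ^ m i).natDegree ≤ if i = l then m l else 0 := by
      intro i _
      by_cases hil : i = l
      · subst hil
        simp [g]
      · simp only [g, if_neg hil, ← Polynomial.C_pow, Polynomial.natDegree_C, le_refl]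
    refine (Finset.sum_le_sum h1).trans ?_
    rw [Finset.sum_ite_eq']
    split_ifs
    · exact MvPolynomial.monomial_le_degreeOf l hm
    · exact Nat.zero_le _
  · rw [← Polynomial.coe_evalRingHom, MvPolynomial.aeval_def, MvPolynomial.eval₂_eq,
      MvPolynomial.eval_eq, map_sum]
    refine Finset.sum_congr rfl fun m _ => ?_
    rw [map_mul, map_prod]
    congr 1
    · simp
    · refine Finset.prod_congr rfl fun i _ => ?_
      by_cases hil : i = l
      · subst hil
        simp [g]
      · simp [g, hil]

/-- The sup bound on a box, obtained by integrating out one variable after the other. -/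
lemma enorm_eval_rpow_le_setLIntegral_pi {ι : Type*} [Fintype ι] [DecidableEq ι]
    (P : MvPolynomial ι ℝ) {r : ι → ℕ} (hr : ∀ l, P.degreeOf l ≤ r l) {a : ℝ} (ha : 0 < a)
    {u h x : ι → ℝ} (hh : ∀ l, 0 < h l) (hx : ∀ l, x l ∈ Icc (u l) (u l + h l)) :
    ‖MvPolynomial.eval x P‖ₑ ^ a ≤ ENNReal.ofReal (∏ l, (supConst (r l) a * (h l)⁻¹)) *
      ∫⁻ y in Set.pi univ fun l => Ioc (u l) (u l + h l), ‖MvPolynomial.eval y P‖ₑ ^ a := by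
  let μ : ι → Measure ℝ := fun l => volume.restrict (Ioc (u l) (u l + h l))
  let F : (ι → ℝ) → ℝ≥0∞ := fun y => ‖MvPolynomial.eval y P‖ₑ ^ a
  have hF : Measurable F := (P.continuous_eval.measurable.enorm).pow_const a
  have hpos : ∀ l, 0 < supConst (r l) a * (h l)⁻¹ := fun l =>
    mul_pos (supConst_pos _ _) (inv_pos.2 (hh l))
  have key : ∀ S : Finset ι, ∀ z : ι → ℝ, (∀ l ∈ S, z l ∈ Icc (u l) (u l + h l)) →
      F z ≤ ENNReal.ofReal (∏ l ∈ S, (supConst (r l) a * (h l)⁻¹)) * (∫⋯∫⁻_S, F ∂μ) z := by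
    intro S
    induction S using Finset.induction_on with
    | empty => intro z _; simp [lmarginal_empty]
    | insert l S hl ih =>
      intro z hz
      obtain ⟨f, hfdeg, hf⟩ := exists_polynomial_eval_update P z l
      have h1 := enorm_eval_rpow_le_lintegral f (hfdeg.trans (hr l)) ha (hh l)
        (hz l (Finset.mem_insert_self _ _))
      have h2 : F z = ‖f.eval (z l)‖ₑ ^ a := by
        rw [← hf (z l), Function.update_eq_self]
      rw [h2]
      refine h1.trans ?_
      rw [lmarginal_insert F hF hl, Finset.prod_insert hl, ENNReal.ofReal_mul (hpos l).le,
        mul_assoc]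
      gcongr
      rw [← lintegral_const_mul' _ _ ENNReal.ofReal_ne_top]
      refine lintegral_mono fun y => ?_
      rw [← hf y]
      refine ih (Function.update z l y) fun i hi => ?_
      have : i ≠ l := fun h => hl (h ▸ hi)
      rw [Function.update_of_ne this]
      exact hz i (Finset.mem_insert_of_mem hi)
  have h3 := key Finset.univ x fun l _ => hx l
  rw [lmarginal_univ, ← Measure.restrict_pi_pi] at h3
  exact h3

/-! ### Dyadic cells -/

/-- The position of the dyadic interval of level `n` that contains `x ≥ 0`. Since the intervals are
closed on the right, this is `⌈2^n x⌉ - 1`, truncated at `0` for `x = 0`. -/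
noncomputable def cellIndex (n : ℕ) (x : ℝ) : ℕ := ⌈(2 : ℝ) ^ n * x⌉₊ - 1

lemma mem_dyadicInterval_iff {n k : ℕ} {x : ℝ} :
    x ∈ dyadicInterval n k ↔ 0 ≤ x ∧ cellIndex n x = k := by
  have h2 : (0 : ℝ) < 2 ^ n := by positivity
  unfold dyadicInterval cellIndex
  split_ifs with hk
  · subst hk
    rw [Nat.sub_eq_zero_iff_le, Nat.ceil_le, mem_Icc, Nat.cast_one,
      ← one_div, le_div_iff₀' h2]
  · have hne : k + 1 ≠ 0 := k.succ_ne_zero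
    have : (⌈(2 : ℝ) ^ n * x⌉₊ - 1 = k) ↔ ⌈(2 : ℝ) ^ n * x⌉₊ = k + 1 := by omega
    rw [this, Nat.ceil_eq_iff hne, mem_Ioc, ← div_eq_mul_inv, ← div_eq_mul_inv,
      div_lt_iff₀' h2, le_div_iff₀' h2]
    simp only [Nat.add_sub_cancel, Nat.cast_add, Nat.cast_one]
    refine ⟨fun h => ⟨?_, h⟩, fun h => h.2⟩
    by_contra hx
    have h3 : (2 : ℝ) ^ n * x ≤ 0 := mul_nonpos_of_nonneg_of_nonpos h2.le (not_le.1 hx).le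
    have h4 : (0 : ℝ) ≤ k := k.cast_nonneg
    linarith [h.1]

lemma cellIndex_lt {n : ℕ} {x : ℝ} (hx : x ≤ 1) : cellIndex n x < 2 ^ n := by
  have h : ⌈(2 : ℝ) ^ n * x⌉₊ ≤ 2 ^ n := by
    rw [Nat.ceil_le]
    push_cast
    have h2 : (0 : ℝ) < 2 ^ n := by positivity
    nlinarith
  have : 0 < 2 ^ n := by positivity
  unfold cellIndex
  omega

lemma cellIndex_succ_div_two (n : ℕ) (x : ℝ) : cellIndex (n + 1) x / 2 = cellIndex n x := by
  unfold cellIndex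
  set y : ℝ := 2 ^ n * x with hy
  have h2 : (2 : ℝ) ^ (n + 1) * x = 2 * y := by rw [hy]; ring
  rw [h2]
  rcases le_or_gt y 0 with h0 | h0
  · rw [Nat.ceil_eq_zero.2 h0, Nat.ceil_eq_zero.2 (by linarith)]
  · have h1 : 0 < ⌈y⌉₊ := Nat.ceil_pos.2 h0
    have h3 : ⌈2 * y⌉₊ ≤ 2 * ⌈y⌉₊ := by
      rw [Nat.ceil_le]
      push_cast
      linarith [Nat.le_ceil y]
    have h4 : 2 * (⌈y⌉₊ - 1) < ⌈2 * y⌉₊ := by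
      rw [Nat.lt_ceil]
      push_cast [Nat.cast_sub h1]
      linarith [Nat.ceil_lt_add_one h0.le]
    omega

lemma cellIndex_congr_of_le {n m : ℕ} (hnm : n ≤ m) {x y : ℝ}
    (h : cellIndex m x = cellIndex m y) : cellIndex n x = cellIndex n y := by
  induction m, hnm using Nat.le_induction with
  | base => exact h
  | succ m _ ih =>
    refine ih ?_
    rw [← cellIndex_succ_div_two m x, ← cellIndex_succ_div_two m y, h]

lemma dyadicInterval_subset_Icc (n k : ℕ) :
    dyadicInterval n k ⊆ Icc ((k : ℝ) * (2 ^ n)⁻¹) ((k : ℝ) * (2 ^ n)⁻¹ + (2 ^ n)⁻¹) := by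
  intro x hx
  unfold dyadicInterval at hx
  split_ifs at hx with hk
  · subst hk
    simpa using hx
  · exact ⟨hx.1.le, by linarith [hx.2]⟩

lemma Ioc_subset_dyadicInterval (n k : ℕ) :
    Ioc ((k : ℝ) * (2 ^ n)⁻¹) ((k : ℝ) * (2 ^ n)⁻¹ + (2 ^ n)⁻¹) ⊆ dyadicInterval n k := by
  intro x hx
  unfold dyadicInterval
  split_ifs with hk
  · subst hk
    have := Ioc_subset_Icc_self hx
    simpa using this
  · exact ⟨hx.1, by linarith [hx.2]⟩

lemma measurableSet_dyadicRectangle {d : ℕ} (j k : Fin d → ℕ) :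
    MeasurableSet (dyadicRectangle j k) := by
  refine MeasurableSet.univ_pi fun l => ?_
  unfold dyadicInterval
  split_ifs
  · exact measurableSet_Icc
  · exact measurableSet_Ioc

/-- The positions in all directions of the cell of the `j`-th anisotropic grid containing `x`. -/
noncomputable def gridIndex {d : ℕ} (σ : Fin d → ℝ) (j : ℕ) (x : Fin d → ℝ) : Fin d → ℕ :=
  fun l => cellIndex (gridLevel σ j l) (x l)

/-- The cell of the `j`-th anisotropic grid containing `x`. -/
noncomputable def gridCell {d : ℕ} (σ : Fin d → ℝ) (j : ℕ) (x : Fin d → ℝ) : Set (Fin d → ℝ) :=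
  dyadicRectangle (gridLevel σ j) (gridIndex σ j x)

variable {d : ℕ} {σ : Fin d → ℝ}

lemma mem_cube_iff {x : Fin d → ℝ} : x ∈ cube d ↔ ∀ l, 0 ≤ x l ∧ x l ≤ 1 := by
  simp only [cube, mem_Icc, Pi.le_def, Pi.zero_apply, Pi.one_apply, forall_and]

lemma gridIndex_lt {x : Fin d → ℝ} (hx : x ∈ cube d) (j : ℕ) (l : Fin d) :
    gridIndex σ j x l < 2 ^ gridLevel σ j l :=
  cellIndex_lt ((mem_cube_iff.1 hx l).2)

lemma mem_dyadicRectangle_iff {j : ℕ} {k : Fin d → ℕ} {x : Fin d → ℝ} :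
    x ∈ dyadicRectangle (gridLevel σ j) k ↔ (∀ l, 0 ≤ x l) ∧ gridIndex σ j x = k := by
  simp only [dyadicRectangle, mem_univ_pi, mem_dyadicInterval_iff, forall_and, funext_iff,
    gridIndex]

lemma dyadicRectangle_subset_cube {j k : Fin d → ℕ} (hk : ∀ l, k l < 2 ^ j l) :
    dyadicRectangle j k ⊆ cube d := by
  intro x hx
  rw [mem_cube_iff]
  intro l
  have hxl : x l ∈ dyadicInterval (j l) (k l) := hx l (mem_univ l)
  refine ⟨(mem_dyadicInterval_iff.1 hxl).1, ?_⟩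
  have h1 := (dyadicInterval_subset_Icc _ _ hxl).2
  have h2 : (0 : ℝ) < 2 ^ j l := by positivity
  have h3 : ((k l : ℕ) : ℝ) + 1 ≤ 2 ^ j l := by exact_mod_cast hk l
  calc x l ≤ (k l + 1) * ((2 : ℝ) ^ j l)⁻¹ := by linarith
    _ ≤ 2 ^ j l * ((2 : ℝ) ^ j l)⁻¹ := by gcongr
    _ = 1 := mul_inv_cancel₀ h2.ne'

lemma mem_gridCell_self {x : Fin d → ℝ} (hx : x ∈ cube d) (j : ℕ) : x ∈ gridCell σ j x :=
  mem_dyadicRectangle_iff.2 ⟨fun l => ((mem_cube_iff.1 hx) l).1, rfl⟩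

lemma gridCell_subset_cube {x : Fin d → ℝ} (hx : x ∈ cube d) (j : ℕ) :
    gridCell σ j x ⊆ cube d :=
  dyadicRectangle_subset_cube (gridIndex_lt hx j)

lemma gridIndex_eq_of_mem_gridCell {x y : Fin d → ℝ} {j : ℕ} (h : y ∈ gridCell σ j x) :
    gridIndex σ j y = gridIndex σ j x :=
  (mem_dyadicRectangle_iff.1 h).2

lemma mem_gridCell_of_gridIndex_eq {x y : Fin d → ℝ} (hy : y ∈ cube d) {j : ℕ}
    (h : gridIndex σ j y = gridIndex σ j x) : y ∈ gridCell σ j x :=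
  mem_dyadicRectangle_iff.2 ⟨fun l => ((mem_cube_iff.1 hy) l).1, h⟩

lemma gridCell_mem_anisotropicGrid {x : Fin d → ℝ} (hx : x ∈ cube d) (j : ℕ) :
    gridCell σ j x ∈ anisotropicGrid σ j :=
  ⟨gridIndex σ j x, gridIndex_lt hx j, rfl⟩

lemma isDyadicRectangle_gridCell {x : Fin d → ℝ} (hx : x ∈ cube d) (j : ℕ) :
    IsDyadicRectangle (gridCell σ j x) :=
  ⟨gridLevel σ j, gridIndex σ j x, gridIndex_lt hx j, rfl⟩

/-- Every cell of the grid is nonempty: it contains its upper right corner. -/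
lemma exists_gridCell_eq {j : ℕ} {K : Set (Fin d → ℝ)} (hK : K ∈ anisotropicGrid σ j) :
    ∃ x ∈ cube d, K = gridCell σ j x := by
  obtain ⟨k, hk, rfl⟩ := hK
  let x : Fin d → ℝ := fun l => (k l : ℝ) * (2 ^ gridLevel σ j l)⁻¹ + (2 ^ gridLevel σ j l)⁻¹
  have hx : x ∈ dyadicRectangle (gridLevel σ j) k := by
    intro l _
    refine Ioc_subset_dyadicInterval _ _ ⟨?_, le_rfl⟩
    simp only [x, lt_add_iff_pos_right]
    positivity
  refine ⟨x, dyadicRectangle_subset_cube hk hx, ?_⟩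
  rw [gridCell, (mem_dyadicRectangle_iff.1 hx).2]

/-- The finite set of all positions of cells in the `j`-th grid. -/
noncomputable def gridPositions (σ : Fin d → ℝ) (j : ℕ) : Finset (Fin d → ℕ) :=
  Fintype.piFinset fun l => Finset.range (2 ^ gridLevel σ j l)

lemma gridIndex_mem_gridPositions {x : Fin d → ℝ} (hx : x ∈ cube d) (j : ℕ) :
    gridIndex σ j x ∈ gridPositions σ j := by
  simp only [gridPositions, Fintype.mem_piFinset, Finset.mem_range]
  exact gridIndex_lt hx j

lemma card_gridPositions (σ : Fin d → ℝ) (j : ℕ) :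
    (gridPositions σ j).card = ∏ l, 2 ^ gridLevel σ j l := by
  simp [gridPositions]

/-! ### Growth of the grids -/

/-- The growth rate `min(σ) ∑ 1 / σ_l` of the grids: the `j`-th grid has about `2^(j β)` cells. -/
noncomputable def gridRate (σ : Fin d → ℝ) : ℝ := minSmoothness σ * ∑ l, 1 / σ l

lemma minSmoothness_le (σ : Fin d → ℝ) (l : Fin d) : minSmoothness σ ≤ σ l :=
  ciInf_le (Set.finite_range σ).bddBelow l

lemma minSmoothness_pos (hd : 0 < d) (hσ : ∀ l, 0 < σ l) : 0 < minSmoothness σ := by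
  have : Nonempty (Fin d) := ⟨⟨0, hd⟩⟩
  obtain ⟨l, hl⟩ := exists_eq_ciInf_of_finite (f := σ)
  rw [minSmoothness, ← hl]
  exact hσ l

lemma gridRate_pos (hd : 0 < d) (hσ : ∀ l, 0 < σ l) : 0 < gridRate σ := by
  have : Nonempty (Fin d) := ⟨⟨0, hd⟩⟩
  refine mul_pos (minSmoothness_pos hd hσ) (Finset.sum_pos (fun l _ => ?_) Finset.univ_nonempty)
  have := hσ l
  positivity

lemma harmonicMean_eq (hd : 0 < d) (hσ : ∀ l, 0 < σ l) :
    harmonicMean σ = d * minSmoothness σ / gridRate σ := by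
  have h0 := minSmoothness_pos hd hσ
  have h1 := gridRate_pos hd hσ
  have h2 : (0 : ℝ) < d := by exact_mod_cast hd
  unfold gridRate at *
  have h3 : 0 < ∑ l, 1 / σ l := (mul_pos_iff_of_pos_left h0).1 h1
  unfold harmonicMean
  field_simp

lemma gridLevel_mono (hd : 0 < d) (hσ : ∀ l, 0 < σ l) {i j : ℕ} (hij : i ≤ j) (l : Fin d) :
    gridLevel σ i l ≤ gridLevel σ j l := by
  have h0 := minSmoothness_pos hd hσ
  have h1 := hσ l
  unfold gridLevel
  gcongr

lemma gridLevel_succ_le (hd : 0 < d) (hσ : ∀ l, 0 < σ l) (j : ℕ) (l : Fin d) :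
    gridLevel σ (j + 1) l ≤ gridLevel σ j l + 1 := by
  have h0 := minSmoothness_pos hd hσ
  have h1 := hσ l
  unfold gridLevel
  rw [← Nat.floor_add_one (by positivity)]
  apply Nat.floor_le_floor
  push_cast
  have : minSmoothness σ / σ l ≤ 1 := (div_le_one h1).2 (minSmoothness_le σ l)
  have h2 : ((j : ℝ) + 1) * minSmoothness σ / σ l
      = (j : ℝ) * minSmoothness σ / σ l + minSmoothness σ / σ l := by ring
  linarith

lemma prod_two_pow_gridLevel_le (hd : 0 < d) (hσ : ∀ l, 0 < σ l) (j : ℕ) :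
    ∏ l, (2 : ℝ) ^ gridLevel σ j l ≤ (2 : ℝ) ^ ((j : ℝ) * gridRate σ) := by
  have h0 := minSmoothness_pos hd hσ
  rw [Finset.prod_pow_eq_pow_sum, ← Real.rpow_natCast]
  refine Real.rpow_le_rpow_of_exponent_le one_le_two ?_
  push_cast
  have : (j : ℝ) * gridRate σ = ∑ l, (j : ℝ) * minSmoothness σ / σ l := by
    rw [gridRate, ← mul_assoc, Finset.mul_sum]
    refine Finset.sum_congr rfl fun l _ => by ring
  rw [this]
  refine Finset.sum_le_sum fun l _ => Nat.floor_le ?_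
  have := hσ l
  positivity

lemma gridIndex_congr_of_le (hd : 0 < d) (hσ : ∀ l, 0 < σ l) {i j : ℕ} (hij : i ≤ j)
    {x y : Fin d → ℝ} (h : gridIndex σ j x = gridIndex σ j y) :
    gridIndex σ i x = gridIndex σ i y :=
  funext fun l => cellIndex_congr_of_le (gridLevel_mono hd hσ hij l) (congrFun h l)

/-- A cell has at most `2^d` children: each side is halved or kept. -/
lemma card_image_gridIndex_succ_le (hd : 0 < d) (hσ : ∀ l, 0 < σ l) (j : ℕ) (x : Fin d → ℝ)
    (S : Finset (Fin d → ℕ))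
    (hS : ∀ c ∈ S, ∃ y, gridIndex σ j y = gridIndex σ j x ∧ gridIndex σ (j + 1) y = c) :
    S.card ≤ 2 ^ d := by
  have hcard : (Fintype.piFinset fun _ : Fin d => Finset.range 2).card = 2 ^ d := by simp
  rw [← hcard]
  refine Finset.card_le_card_of_injOn (fun c l => c l % 2) ?_ ?_
  · intro c _
    simp only [Finset.mem_coe, Fintype.mem_piFinset, Finset.mem_range]
    exact fun l => Nat.mod_lt _ two_pos
  · intro c hc c' hc' hcc
    obtain ⟨y, hy, rfl⟩ := hS c hc
    obtain ⟨y', hy', rfl⟩ := hS c' hc'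
    funext l
    have h1 : cellIndex (gridLevel σ j l) (y l) = cellIndex (gridLevel σ j l) (y' l) :=
      congrFun (hy.trans hy'.symm) l
    have h2 : cellIndex (gridLevel σ (j + 1) l) (y l) % 2
        = cellIndex (gridLevel σ (j + 1) l) (y' l) % 2 := congrFun hcc l
    change cellIndex (gridLevel σ (j + 1) l) (y l) = cellIndex (gridLevel σ (j + 1) l) (y' l)
    have h3 := gridLevel_succ_le hd hσ j l
    have h4 := gridLevel_mono hd hσ (Nat.le_add_right j 1) l
    rcases (by omega : gridLevel σ (j + 1) l = gridLevel σ j l ∨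
      gridLevel σ (j + 1) l = gridLevel σ j l + 1) with h | h
    · rw [h]; exact h1
    · rw [h] at h2 ⊢
      rw [← cellIndex_succ_div_two _ (y l), ← cellIndex_succ_div_two _ (y' l)] at h1
      omega

/-! ### Piecewise polynomials -/

lemma measurableSet_cube (d : ℕ) : MeasurableSet (cube d) := measurableSet_Icc

instance isProbabilityMeasure_cubeMeasure (d : ℕ) : IsProbabilityMeasure (cubeMeasure d) := by
  constructor
  rw [cubeMeasure, Measure.restrict_apply_univ, cube, Real.volume_Icc_pi]
  simp

/-- Piecewise polynomials need not be measurable outside the cube, but they are measurable for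
Lebesgue measure on the cube. -/
lemma aestronglyMeasurable_of_mem_piecewisePoly {r : Fin d → ℕ} {𝒦 : Set (Set (Fin d → ℝ))}
    (hfin : 𝒦.Countable) (hmeas : ∀ K ∈ 𝒦, MeasurableSet K) (hcov : cube d ⊆ ⋃₀ 𝒦)
    {t : (Fin d → ℝ) → ℝ} (ht : t ∈ piecewisePoly r 𝒦) :
    AEStronglyMeasurable t (cubeMeasure d) := by
  have := hfin.to_subtype
  have h : AEStronglyMeasurable t (volume.restrict (⋃ K : 𝒦, (K : Set (Fin d → ℝ)))) := by
    rw [aestronglyMeasurable_iUnion_iff]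
    rintro ⟨K, hK⟩
    obtain ⟨P, -, hP⟩ := ht K hK
    refine (P.continuous_eval.aestronglyMeasurable).congr ?_
    filter_upwards [ae_restrict_mem (hmeas K hK)] with x hx using (hP x hx).symm
  exact h.mono_measure (Measure.restrict_mono (by rwa [← sUnion_eq_iUnion]) le_rfl)

lemma countable_anisotropicGrid (σ : Fin d → ℝ) (j : ℕ) : (anisotropicGrid σ j).Countable := by
  refine (countable_range fun k : Fin d → ℕ => dyadicRectangle (gridLevel σ j) k).mono ?_
  rintro K ⟨k, -, rfl⟩
  exact mem_range_self k

lemma aestronglyMeasurable_of_mem_grid {r : Fin d → ℕ} {j : ℕ} {t : (Fin d → ℝ) → ℝ}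
    (ht : t ∈ piecewisePoly r (anisotropicGrid σ j)) :
    AEStronglyMeasurable t (cubeMeasure d) := by
  refine aestronglyMeasurable_of_mem_piecewisePoly (countable_anisotropicGrid σ j) ?_ ?_ ht
  · rintro K ⟨k, -, rfl⟩
    exact measurableSet_dyadicRectangle _ _
  · exact fun x hx => mem_sUnion_of_mem (mem_gridCell_self hx j) (gridCell_mem_anisotropicGrid hx j)

lemma gridCell_subset_gridCell (hd : 0 < d) (hσ : ∀ l, 0 < σ l) {i j : ℕ} (hij : i ≤ j)
    {x : Fin d → ℝ} (hx : x ∈ cube d) : gridCell σ j x ⊆ gridCell σ i x := fun _ hy =>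
  mem_gridCell_of_gridIndex_eq (gridCell_subset_cube hx j hy)
    (gridIndex_congr_of_le hd hσ hij (gridIndex_eq_of_mem_gridCell hy))

lemma piecewisePoly_grid_mono (hd : 0 < d) (hσ : ∀ l, 0 < σ l) {r : Fin d → ℕ} {i j : ℕ}
    (hij : i ≤ j) :
    piecewisePoly r (anisotropicGrid σ i) ⊆ piecewisePoly r (anisotropicGrid σ j) := by
  intro t ht K hK
  obtain ⟨x, hx, rfl⟩ := exists_gridCell_eq hK
  obtain ⟨P, hP, htP⟩ := ht _ (gridCell_mem_anisotropicGrid hx i)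
  exact ⟨P, hP, fun y hy => htP y (gridCell_subset_gridCell hd hσ hij hx hy)⟩

lemma sub_mem_piecewisePoly {r : Fin d → ℕ} {𝒦 : Set (Set (Fin d → ℝ))}
    {t u : (Fin d → ℝ) → ℝ} (ht : t ∈ piecewisePoly r 𝒦) (hu : u ∈ piecewisePoly r 𝒦) :
    t - u ∈ piecewisePoly r 𝒦 := by
  intro K hK
  obtain ⟨P, hP, htP⟩ := ht K hK
  obtain ⟨Q, hQ, huQ⟩ := hu K hK
  refine ⟨P - Q, fun l => (MvPolynomial.degreeOf_sub_le l P Q).trans (max_le (hP l) (hQ l)), ?_⟩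
  intro x hx
  rw [Pi.sub_apply, htP x hx, huQ x hx, map_sub]

/-- The constant in the sup bound on grid cells. -/
noncomputable def cellConst (r : Fin d → ℕ) (a : ℝ) : ℝ := ∏ l, supConst (r l) a

lemma cellConst_pos (r : Fin d → ℕ) (a : ℝ) : 0 < cellConst r a :=
  Finset.prod_pos fun _ _ => supConst_pos _ _

/-- The sup bound on the cell of the `j`-th grid containing a given point: the inverse of the
volume of the cell is at most `2^(jβ)`. -/
lemma enorm_rpow_le_setLIntegral_gridCell (hd : 0 < d) (hσ : ∀ l, 0 < σ l) {r : Fin d → ℕ}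
    {j : ℕ} {t : (Fin d → ℝ) → ℝ} (ht : t ∈ piecewisePoly r (anisotropicGrid σ j)) {a : ℝ}
    (ha : 0 < a) {x : Fin d → ℝ} (hx : x ∈ cube d) :
    ‖t x‖ₑ ^ a ≤ ENNReal.ofReal (cellConst r a * (2 : ℝ) ^ ((j : ℝ) * gridRate σ)) *
      ∫⁻ y in gridCell σ j x, ‖t y‖ₑ ^ a := by
  obtain ⟨P, hP, htP⟩ := ht _ (gridCell_mem_anisotropicGrid hx j)
  have hxc := mem_gridCell_self (σ := σ) hx j
  rw [htP x hxc]
  have hxI : ∀ l, x l ∈ Icc ((gridIndex σ j x l : ℝ) * (2 ^ gridLevel σ j l)⁻¹)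
      ((gridIndex σ j x l : ℝ) * (2 ^ gridLevel σ j l)⁻¹ + (2 ^ gridLevel σ j l)⁻¹) :=
    fun l => dyadicInterval_subset_Icc _ _ (hxc l (mem_univ l))
  refine (enorm_eval_rpow_le_setLIntegral_pi P hP ha (fun l => by positivity) hxI).trans ?_
  refine mul_le_mul' (ENNReal.ofReal_le_ofReal ?_) ?_
  · simp only [inv_inv, Finset.prod_mul_distrib]
    exact mul_le_mul_of_nonneg_left (prod_two_pow_gridLevel_le hd hσ j) (cellConst_pos r a).le
  · have hsub : (Set.pi univ fun l => Ioc ((gridIndex σ j x l : ℝ) * (2 ^ gridLevel σ j l)⁻¹)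
        ((gridIndex σ j x l : ℝ) * (2 ^ gridLevel σ j l)⁻¹ + (2 ^ gridLevel σ j l)⁻¹)) ⊆
        gridCell σ j x := Set.pi_mono fun l _ => Ioc_subset_dyadicInterval _ _
    refine (lintegral_mono_set hsub).trans_eq ?_
    exact setLIntegral_congr_fun (measurableSet_dyadicRectangle _ _) fun y hy => by
      rw [htP y hy]

lemma eLpNorm_rpow_toReal {p : ℝ≥0∞} (hp : p ≠ 0) (hp_top : p ≠ ∞) (t : (Fin d → ℝ) → ℝ) :
    eLpNorm t p (cubeMeasure d) ^ p.toReal = ∫⁻ y in cube d, ‖t y‖ₑ ^ p.toReal := by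
  rw [eLpNorm_eq_lintegral_rpow_enorm_toReal hp hp_top, ← ENNReal.rpow_mul,
    one_div_mul_cancel (ENNReal.toReal_pos hp hp_top).ne', ENNReal.rpow_one, cubeMeasure]

/-- A weak-type bound: the number of cells of the `i`-th grid on which a piecewise polynomial on a
finer grid exceeds a threshold `v` is controlled by its `L_p` norm. -/
lemma card_mul_rpow_le_eLpNorm_rpow (hd : 0 < d) (hσ : ∀ l, 0 < σ l) {r : Fin d → ℕ} {i j : ℕ}
    (hij : i ≤ j) {t : (Fin d → ℝ) → ℝ} (ht : t ∈ piecewisePoly r (anisotropicGrid σ j))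
    {p : ℝ≥0∞} (hp : p ≠ 0) (hp_top : p ≠ ∞) (v : ℝ≥0∞) (S : Finset (Fin d → ℕ))
    (hS : ∀ c ∈ S, ∃ x ∈ cube d, gridIndex σ i x = c ∧ v ≤ ‖t x‖ₑ) :
    (S.card : ℝ≥0∞) * v ^ p.toReal ≤
      ENNReal.ofReal (cellConst r p.toReal * (2 : ℝ) ^ ((j : ℝ) * gridRate σ)) *
        eLpNorm t p (cubeMeasure d) ^ p.toReal := by
  have ha := ENNReal.toReal_pos hp hp_top
  set A := ENNReal.ofReal (cellConst r p.toReal * (2 : ℝ) ^ ((j : ℝ) * gridRate σ))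
  let cell : (Fin d → ℕ) → Set (Fin d → ℝ) := dyadicRectangle (gridLevel σ i)
  have hterm : ∀ c ∈ S, v ^ p.toReal ≤ A * ∫⁻ y in cell c, ‖t y‖ₑ ^ p.toReal := by
    intro c hc
    obtain ⟨x, hx, rfl, hv⟩ := hS c hc
    calc v ^ p.toReal ≤ ‖t x‖ₑ ^ p.toReal := ENNReal.rpow_le_rpow hv ha.le
      _ ≤ A * ∫⁻ y in gridCell σ j x, ‖t y‖ₑ ^ p.toReal :=
          enorm_rpow_le_setLIntegral_gridCell hd hσ ht ha hx
      _ ≤ A * ∫⁻ y in gridCell σ i x, ‖t y‖ₑ ^ p.toReal := by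
          gcongr
          exact gridCell_subset_gridCell hd hσ hij hx
  calc (S.card : ℝ≥0∞) * v ^ p.toReal = ∑ _c ∈ S, v ^ p.toReal := by simp
    _ ≤ ∑ c ∈ S, A * ∫⁻ y in cell c, ‖t y‖ₑ ^ p.toReal := Finset.sum_le_sum hterm
    _ = A * ∫⁻ y in ⋃ c ∈ S, cell c, ‖t y‖ₑ ^ p.toReal := by
        rw [lintegral_biUnion_finset, Finset.mul_sum]
        · intro c _ c' _ hcc
          refine Set.disjoint_left.2 fun y hy hy' => hcc ?_
          rw [← (mem_dyadicRectangle_iff.1 hy).2, (mem_dyadicRectangle_iff.1 hy').2]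
        · exact fun c _ => measurableSet_dyadicRectangle _ _
    _ ≤ A * ∫⁻ y in cube d, ‖t y‖ₑ ^ p.toReal := by
        gcongr
        refine iUnion₂_subset fun c hc => ?_
        obtain ⟨x, hx, rfl, -⟩ := hS c hc
        exact gridCell_subset_cube hx i
    _ = _ := by rw [eLpNorm_rpow_toReal hp hp_top]

/-- On a fixed grid, the sup norm of piecewise polynomials is controlled by the `L_p` norm. -/
lemma enorm_le_mul_eLpNorm (hd : 0 < d) (hσ : ∀ l, 0 < σ l) {r : Fin d → ℕ} {j : ℕ}
    {t : (Fin d → ℝ) → ℝ} (ht : t ∈ piecewisePoly r (anisotropicGrid σ j)) {p : ℝ≥0∞}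
    (hp : p ≠ 0) (hp_top : p ≠ ∞) {x : Fin d → ℝ} (hx : x ∈ cube d) :
    ‖t x‖ₑ ≤ ENNReal.ofReal (cellConst r p.toReal * (2 : ℝ) ^ ((j : ℝ) * gridRate σ)) ^
      (1 / p.toReal) * eLpNorm t p (cubeMeasure d) := by
  have ha := ENNReal.toReal_pos hp hp_top
  have h := card_mul_rpow_le_eLpNorm_rpow hd hσ le_rfl ht hp hp_top ‖t x‖ₑ {gridIndex σ j x}
    (by simpa using ⟨x, hx, rfl, le_rfl⟩)
  rw [Finset.card_singleton, Nat.cast_one, one_mul] at h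
  have h2 := ENNReal.rpow_le_rpow h (one_div_pos.2 ha).le
  rwa [ENNReal.mul_rpow_of_nonneg _ _ (one_div_pos.2 ha).le, ← ENNReal.rpow_mul,
    ← ENNReal.rpow_mul, mul_one_div_cancel ha.ne', ENNReal.rpow_one, ENNReal.rpow_one] at h2

/-! ### Norm inequalities -/

section Norms

variable {α : Type*} [MeasurableSpace α] {μ : Measure α}

/-- Lower semicontinuity of the `L_q` norm under convergence in `L_p`. -/
lemma eLpNorm_le_of_tendsto_eLpNorm {p q M : ℝ≥0∞} (hp : p ≠ 0) {f : ℕ → α → ℝ} {g : α → ℝ}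
    (hf : ∀ n, AEStronglyMeasurable (f n) μ) (hg : AEStronglyMeasurable g μ)
    (hlim : Filter.Tendsto (fun n => eLpNorm (f n - g) p μ) Filter.atTop (nhds 0))
    (hM : ∀ᶠ n in Filter.atTop, eLpNorm (f n) q μ ≤ M) : eLpNorm g q μ ≤ M := by
  obtain ⟨ns, hns, hae⟩ :=
    (tendstoInMeasure_of_tendsto_eLpNorm hp hf hg hlim).exists_seq_tendsto_ae
  refine (Lp.eLpNorm_lim_le_liminf_eLpNorm (fun n => hf (ns n)) g hae).trans ?_
  exact Filter.liminf_le_of_frequently_le' (hns.tendsto_atTop.eventually hM).frequently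

/-- Interpolation between `L_p` and `L_∞`. For `q = ∞` the ratio `p.toReal / q.toReal` is `0`. -/
lemma eLpNorm_le_rpow_mul_eLpNorm_rpow {p q : ℝ≥0∞} (hp : p ≠ 0) (hpq : p < q) {f : α → ℝ}
    {v : ℝ≥0∞} (hv : v ≠ ∞) (hf : ∀ x, ‖f x‖ₑ ≤ v) :
    eLpNorm f q μ ≤
      v ^ (1 - p.toReal / q.toReal) * eLpNorm f p μ ^ (p.toReal / q.toReal) := by
  have hp_top : p ≠ ∞ := hpq.ne_top
  have ha := ENNReal.toReal_pos hp hp_top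
  rcases eq_or_ne q ∞ with rfl | hq
  · simp only [ENNReal.toReal_top, div_zero, sub_zero, ENNReal.rpow_one, ENNReal.rpow_zero,
      mul_one]
    exact eLpNormEssSup_le_of_ae_enorm_bound (Filter.Eventually.of_forall hf)
  · have hq0 : q ≠ 0 := (hpq.trans_le' bot_le).ne'
    have hb := ENNReal.toReal_pos hq0 hq
    have hab : p.toReal < q.toReal := (ENNReal.toReal_lt_toReal hp_top hq).2 hpq
    rw [eLpNorm_eq_lintegral_rpow_enorm_toReal hq0 hq,
      eLpNorm_eq_lintegral_rpow_enorm_toReal hp hp_top, ← ENNReal.rpow_mul]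
    have h1 : ∀ x, ‖f x‖ₑ ^ q.toReal ≤ v ^ (q.toReal - p.toReal) * ‖f x‖ₑ ^ p.toReal := by
      intro x
      calc ‖f x‖ₑ ^ q.toReal = ‖f x‖ₑ ^ (q.toReal - p.toReal) * ‖f x‖ₑ ^ p.toReal := by
            rw [← ENNReal.rpow_add_of_nonneg _ _ (sub_nonneg.2 hab.le) ha.le, sub_add_cancel]
        _ ≤ _ := by
            exact mul_le_mul_left (ENNReal.rpow_le_rpow (hf x) (sub_nonneg.2 hab.le)) _
    have hvt : v ^ (q.toReal - p.toReal) ≠ ∞ :=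
      ENNReal.rpow_ne_top_of_nonneg (sub_nonneg.2 hab.le) hv
    calc (∫⁻ x, ‖f x‖ₑ ^ q.toReal ∂μ) ^ (1 / q.toReal)
        ≤ (v ^ (q.toReal - p.toReal) * ∫⁻ x, ‖f x‖ₑ ^ p.toReal ∂μ) ^ (1 / q.toReal) := by
          refine ENNReal.rpow_le_rpow ?_ (one_div_pos.2 hb).le
          rw [← lintegral_const_mul' _ _ hvt]
          exact lintegral_mono h1
      _ = _ := by
          rw [ENNReal.mul_rpow_of_nonneg _ _ (one_div_pos.2 hb).le, ← ENNReal.rpow_mul]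
          congr 2
          · field_simp
          · field_simp

end Norms

/-! ### Best approximation -/

lemma exists_lt_of_approxError_lt {p e : ℝ≥0∞} {s : (Fin d → ℝ) → ℝ}
    {T : Set ((Fin d → ℝ) → ℝ)} (h : approxError p s T < e) :
    ∃ t ∈ T, eLpNorm (s - t) p (cubeMeasure d) < e := by
  simpa only [approxError, iInf_lt_iff, exists_prop] using h

lemma approxError_le {p : ℝ≥0∞} {s t : (Fin d → ℝ) → ℝ} {T : Set ((Fin d → ℝ) → ℝ)}
    (ht : t ∈ T) : approxError p s T ≤ eLpNorm (s - t) p (cubeMeasure d) :=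
  iInf₂_le t ht

/-- The quasi-triangle inequality, for the difference of two approximants of `s`. -/
lemma eLpNorm_sub_le_of_approx {p e : ℝ≥0∞} {s t u : (Fin d → ℝ) → ℝ}
    (hs : AEStronglyMeasurable s (cubeMeasure d)) (ht : AEStronglyMeasurable t (cubeMeasure d))
    (hu : AEStronglyMeasurable u (cubeMeasure d)) (h1 : eLpNorm (s - t) p (cubeMeasure d) ≤ e)
    (h2 : eLpNorm (s - u) p (cubeMeasure d) ≤ e) :
    eLpNorm (t - u) p (cubeMeasure d) ≤ p.LpAddConst * (e + e) := by
  have h : t - u = (s - u) - (s - t) := by abel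
  rw [h]
  refine (eLpNorm_sub_le' (hs.sub hu) (hs.sub ht) p).trans ?_
  gcongr

/-- If `s` is a limit in `L_p` of piecewise polynomials on one fixed grid, then so it is in `L_q`:
an approximating sequence is Cauchy for the sup norm. -/
lemma approxError_eq_zero_of_approxError_eq_zero (hd : 0 < d) (hσ : ∀ l, 0 < σ l)
    {r : Fin d → ℕ} {j : ℕ} {p q : ℝ≥0∞} (hp : p ≠ 0) (hp_top : p ≠ ∞)
    {s : (Fin d → ℝ) → ℝ} (hs : AEStronglyMeasurable s (cubeMeasure d))
    (h0 : approxError p s (piecewisePoly r (anisotropicGrid σ j)) = 0) :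
    approxError q s (piecewisePoly r (anisotropicGrid σ j)) = 0 := by
  set T := piecewisePoly r (anisotropicGrid σ j)
  set A := ENNReal.ofReal (cellConst r p.toReal * (2 : ℝ) ^ ((j : ℝ) * gridRate σ)) ^
      (1 / p.toReal) with hA
  have hAt : A ≠ ∞ :=
    ENNReal.rpow_ne_top_of_nonneg (one_div_pos.2 (ENNReal.toReal_pos hp hp_top)).le
      ENNReal.ofReal_ne_top
  have hex : ∀ n : ℕ, ∃ t ∈ T, eLpNorm (s - t) p (cubeMeasure d) < ((n : ℝ≥0∞) + 1)⁻¹ := by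
    intro n
    refine exists_lt_of_approxError_lt ?_
    rw [h0]
    simp
  choose Q hQT hQ using hex
  have hQm : ∀ n, AEStronglyMeasurable (Q n) (cubeMeasure d) := fun n =>
    aestronglyMeasurable_of_mem_grid (hQT n)
  have hinv : Filter.Tendsto (fun n : ℕ => ((n : ℝ≥0∞) + 1)⁻¹) Filter.atTop (nhds 0) := by
    have := ENNReal.tendsto_inv_nat_nhds_zero.comp (Filter.tendsto_add_atTop_nat 1)
    simpa [Function.comp_def] using this
  have hbound : ∀ n : ℕ, approxError q s T ≤
      A * (p.LpAddConst * (((n : ℝ≥0∞) + 1)⁻¹ + ((n : ℝ≥0∞) + 1)⁻¹)) := by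
    intro n
    refine (approxError_le (hQT n)).trans ?_
    refine eLpNorm_le_of_tendsto_eLpNorm (p := p) hp (f := fun m => Q m - Q n)
      (fun m => (hQm m).sub (hQm n)) (hs.sub (hQm n)) ?_ ?_
    · refine tendsto_of_tendsto_of_tendsto_of_le_of_le tendsto_const_nhds hinv
        (fun _ => bot_le) fun m => ?_
      have h : (fun m => Q m - Q n) m - (s - Q n) = -(s - Q m) := by
        simp only
        abel
      simp only at h ⊢
      rw [h, eLpNorm_neg]
      exact (hQ m).le
    · filter_upwards [Filter.eventually_ge_atTop n] with m hm
      have hmn : ((m : ℝ≥0∞) + 1)⁻¹ ≤ ((n : ℝ≥0∞) + 1)⁻¹ := by gcongr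
      have h1 : eLpNorm (Q m - Q n) p (cubeMeasure d) ≤ _ :=
        eLpNorm_sub_le_of_approx hs (hQm m) (hQm n) ((hQ m).le.trans hmn) (hQ n).le
      have h2 : ∀ᵐ x ∂cubeMeasure d, ‖(Q m - Q n) x‖ₑ ≤
          A * (p.LpAddConst * (((n : ℝ≥0∞) + 1)⁻¹ + ((n : ℝ≥0∞) + 1)⁻¹)) := by
        filter_upwards [ae_restrict_mem (measurableSet_cube d)] with x hx
        refine (enorm_le_mul_eLpNorm hd hσ (sub_mem_piecewisePoly (hQT m) (hQT n)) hp hp_top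
          hx).trans ?_
        gcongr
      refine (eLpNorm_le_eLpNorm_of_exponent_le le_top ((hQm m).sub (hQm n))).trans ?_
      exact eLpNormEssSup_le_of_ae_enorm_bound h2
  have hlim : Filter.Tendsto (fun n : ℕ =>
      A * (p.LpAddConst * (((n : ℝ≥0∞) + 1)⁻¹ + ((n : ℝ≥0∞) + 1)⁻¹))) Filter.atTop (nhds 0) := by
    have h1 := hinv.add hinv
    rw [add_zero] at h1
    have h2 := ENNReal.Tendsto.const_mul h1 (Or.inr p.LpAddConst_lt_top.ne)
    have h3 := ENNReal.Tendsto.const_mul h2 (Or.inr hAt)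
    simpa using h3
  exact le_antisymm (ge_of_tendsto' hlim hbound) bot_le

/-! ### Stopping levels in a tree of cells -/

section Stopping

variable {X ι : Type*} (κ : ℕ → X → ι) (M : ℕ → Set X)

/-- For a nested sequence of labellings `κ j` of the points by their cells of level `j`, the cell of
level `j` around `x` is active if it contains a point of some `M i` with `i ≥ j`. -/
def IsActive (j : ℕ) (x : X) : Prop := ∃ i ≥ j, ∃ y ∈ M i, κ j y = κ j x

/-- The first level at which the cell around `x` is not active. -/
noncomputable def stopLevel (x : X) : ℕ := sInf {j | ¬ IsActive κ M j x}

variable {κ M}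

lemma stopLevel_le {j : ℕ} {x : X} (h : ¬ IsActive κ M j x) : stopLevel κ M x ≤ j :=
  Nat.sInf_le h

lemma not_isActive_of_eventually_empty {L : ℕ} (hL : ∀ i ≥ L, M i = ∅) (x : X) :
    ¬ IsActive κ M L x := by
  rintro ⟨i, hi, y, hy, -⟩
  rw [hL i hi] at hy
  exact hy

lemma not_isActive_stopLevel {L : ℕ} (hL : ∀ i ≥ L, M i = ∅) (x : X) :
    ¬ IsActive κ M (stopLevel κ M x) x :=
  Nat.sInf_mem (s := {j | ¬ IsActive κ M j x}) ⟨L, not_isActive_of_eventually_empty hL x⟩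

lemma notMem_of_stopLevel_le {L : ℕ} (hL : ∀ i ≥ L, M i = ∅) {x : X} {i : ℕ}
    (h : stopLevel κ M x ≤ i) : x ∉ M i :=
  fun hx => not_isActive_stopLevel hL x ⟨i, h, x, hx, rfl⟩

lemma isActive_congr {j : ℕ} {x y : X} (h : κ j y = κ j x) :
    IsActive κ M j y ↔ IsActive κ M j x := by
  simp only [IsActive, h]

/-- The stopping level is constant on the cells at which one stops. -/
lemma stopLevel_eq_of_eq {L : ℕ} (hL : ∀ i ≥ L, M i = ∅)
    (hκ : ∀ i j, i ≤ j → ∀ x y, κ j x = κ j y → κ i x = κ i y) {x y : X}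
    (h : κ (stopLevel κ M x) y = κ (stopLevel κ M x) x) :
    stopLevel κ M y = stopLevel κ M x := by
  have h1 : stopLevel κ M y ≤ stopLevel κ M x :=
    stopLevel_le fun ha => not_isActive_stopLevel hL x ((isActive_congr h).1 ha)
  refine le_antisymm h1 (stopLevel_le fun ha => not_isActive_stopLevel (κ := κ) hL y ?_)
  exact (isActive_congr (hκ _ _ h1 _ _ h)).2 ha

/-- The number of cells at which one stops. A cell of level `j + 1` at which one stops is a child of
an active cell of level `j`, and each of the cells of level `i` meeting `M i` has `i + 1` ancestors,
itself included. -/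
lemma exists_finset_stopLevel_card_le {Y : Set X} {L B : ℕ} (hL : ∀ i ≥ L, M i = ∅)
    (hκ : ∀ i j, i ≤ j → ∀ x y, κ j x = κ j y → κ i x = κ i y)
    {V N : ℕ → Finset ι} (hV : ∀ j, ∀ x ∈ Y, κ j x ∈ V j) (hN : ∀ i, ∀ x ∈ M i, κ i x ∈ N i)
    (hB : ∀ j x (S : Finset ι), (∀ c ∈ S, ∃ y, κ j y = κ j x ∧ κ (j + 1) y = c) → S.card ≤ B) :
    ∃ T : Finset (ℕ × ι), (∀ x ∈ Y, (stopLevel κ M x, κ (stopLevel κ M x) x) ∈ T) ∧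
      T.card ≤ (V 0).card + B * ∑ i ∈ Finset.range L, (i + 1) * (N i).card := by
  classical
  let children : ℕ → ℕ → ι → Finset ι := fun j i c =>
    (V (j + 1)).filter fun c' => ∃ z y, κ (j + 1) z = c' ∧ κ i y = c ∧ κ j z = κ j y
  have hchildren : ∀ j i c, j ≤ i → (children j i c).card ≤ B := by
    intro j i c hji
    by_cases hc : ∃ y, κ i y = c
    · obtain ⟨y₀, rfl⟩ := hc
      refine hB j y₀ _ fun c' hc' => ?_
      obtain ⟨-, z, y, hz, hy, hzy⟩ := Finset.mem_filter.1 hc'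
      exact ⟨z, hzy.trans (hκ j i hji _ _ hy), hz⟩
    · have : children j i c = ∅ := by
        refine Finset.filter_eq_empty_iff.2 fun c' _ => ?_
        rintro ⟨z, y, -, hy, -⟩
        exact hc ⟨y, hy⟩
      simp [this]
  let W : ℕ → Finset ι := fun j =>
    (Finset.Ico j L).biUnion fun i => (N i).biUnion fun c => children j i c
  have hW : ∀ j, (W j).card ≤ ∑ i ∈ Finset.Ico j L, (N i).card * B := fun j =>
    Finset.card_biUnion_le.trans <| Finset.sum_le_sum fun i hi =>
      Finset.card_biUnion_le_card_mul _ _ _ fun c _ => hchildren j i c (Finset.mem_Ico.1 hi).1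
  let T : Finset (ℕ × ι) := (V 0).image (fun c => (0, c)) ∪
    (Finset.range L).biUnion fun j => (W j).image fun c => (j + 1, c)
  refine ⟨T, fun x hx => ?_, ?_⟩
  · rcases Nat.eq_zero_or_eq_succ_pred (stopLevel κ M x) with h0 | h0
    · rw [h0]
      exact Finset.mem_union_left _ (Finset.mem_image_of_mem _ (hV 0 x hx))
    · set j := (stopLevel κ M x).pred with hj
      rw [h0]
      have hact : IsActive κ M j x := by
        by_contra hna
        have := stopLevel_le hna
        omega
      obtain ⟨i, hij, y, hy, hyx⟩ := hact
      have hiL : i < L := by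
        by_contra hiL
        rw [hL i (not_lt.1 hiL)] at hy
        exact hy
      refine Finset.mem_union_right _ (Finset.mem_biUnion.2 ⟨j, Finset.mem_range.2
        (hij.trans_lt hiL), Finset.mem_image_of_mem _ ?_⟩)
      refine Finset.mem_biUnion.2 ⟨i, Finset.mem_Ico.2 ⟨hij, hiL⟩, Finset.mem_biUnion.2
        ⟨κ i y, hN i y hy, Finset.mem_filter.2 ⟨hV _ x hx, x, y, rfl, rfl, hyx.symm⟩⟩⟩
  · refine (Finset.card_union_le _ _).trans ?_
    refine Nat.add_le_add Finset.card_image_le ?_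
    calc ((Finset.range L).biUnion fun j => (W j).image fun c => (j + 1, c)).card
        ≤ ∑ j ∈ Finset.range L, ∑ i ∈ Finset.Ico j L, (N i).card * B :=
          Finset.card_biUnion_le.trans <| Finset.sum_le_sum fun j _ =>
            Finset.card_image_le.trans (hW j)
      _ = ∑ i ∈ Finset.range L, ∑ _j ∈ Finset.range (i + 1), (N i).card * B := by
          simp only [Finset.range_eq_Ico]
          exact Finset.sum_Ico_Ico_comm 0 L fun _ i => (N i).card * B
      _ = B * ∑ i ∈ Finset.range L, (i + 1) * (N i).card := by
          rw [Finset.mul_sum]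
          refine Finset.sum_congr rfl fun i _ => ?_
          rw [Finset.sum_const, Finset.card_range, smul_eq_mul]
          ring

end Stopping

/-! ### Partitions with cells of variable level -/

/-- The cells `gridCell σ (J + ℓ x) x` form a partition if the function `ℓ` is constant on each of
them. -/
lemma exists_finpartition_gridCell {d : ℕ} {σ : Fin d → ℝ} (J : ℕ) (ℓ : (Fin d → ℝ) → ℕ)
    (hℓ : ∀ x y, gridIndex σ (J + ℓ x) y = gridIndex σ (J + ℓ x) x → ℓ y = ℓ x)
    (T : Finset (ℕ × (Fin d → ℕ))) (hT : ∀ x ∈ cube d, (ℓ x, gridIndex σ (J + ℓ x) x) ∈ T) :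
    ∃ m : Finpartition (cube d), (∀ K ∈ m.parts, ∃ x ∈ cube d, K = gridCell σ (J + ℓ x) x) ∧
      m.parts.card ≤ T.card := by
  classical
  let parts : Finset (Set (Fin d → ℝ)) :=
    (T.image fun c => dyadicRectangle (gridLevel σ (J + c.1)) c.2).filter
      fun K => ∃ x ∈ cube d, K = gridCell σ (J + ℓ x) x
  have hmem : ∀ K, K ∈ parts ↔ ∃ x ∈ cube d, K = gridCell σ (J + ℓ x) x := by
    intro K
    refine ⟨fun h => (Finset.mem_filter.1 h).2, fun h => Finset.mem_filter.2 ⟨?_, h⟩⟩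
    obtain ⟨x, hx, rfl⟩ := h
    exact Finset.mem_image.2 ⟨_, hT x hx, rfl⟩
  have hcell : ∀ x z, z ∈ gridCell σ (J + ℓ x) x →
      gridCell σ (J + ℓ z) z = gridCell σ (J + ℓ x) x := by
    intro x z hz
    have h1 := gridIndex_eq_of_mem_gridCell hz
    rw [hℓ x z h1, gridCell, gridCell, h1]
  refine ⟨⟨parts, ?_, ?_, ?_⟩, fun K hK => (hmem K).1 hK,
    (Finset.card_filter_le _ _).trans Finset.card_image_le⟩
  · rw [Finset.supIndep_iff_pairwiseDisjoint]
    intro K hK K' hK' hne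
    obtain ⟨x, hx, rfl⟩ := (hmem K).1 hK
    obtain ⟨y, hy, rfl⟩ := (hmem K').1 hK'
    refine Set.disjoint_left.2 fun z hz hz' => hne ?_
    exact (hcell x z hz).symm.trans (hcell y z hz')
  · refine le_antisymm (Finset.sup_le fun K hK => ?_) fun x hx => ?_
    · obtain ⟨x, hx, rfl⟩ := (hmem K).1 hK
      exact gridCell_subset_cube hx _
    · have h1 : gridCell σ (J + ℓ x) x ∈ parts := (hmem _).2 ⟨x, hx, rfl⟩
      exact Finset.le_sup (f := id) h1 (mem_gridCell_self hx _)
  · intro h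
    obtain ⟨x, hx, hK⟩ := (hmem _).1 h
    have := mem_gridCell_self (σ := σ) hx (J + ℓ x)
    rw [← hK] at this
    exact this

/-! ### Adaptive approximation -/

/-- Adaptive refinement from level `J` on, with thresholds `v i`: the cells on which some increment
`P (J + i + 1) - P (J + i)` exceeds `v i` are refined. On the resulting partition, the remaining
part of each increment is at most `v i`, so that its `L_q` norm is estimated by interpolation. -/
lemma exists_finpartition_of_thresholds (hd : 0 < d) (hσ : ∀ l, 0 < σ l) {r : Fin d → ℕ}
    {p q : ℝ≥0∞} (hp : p ≠ 0) (hpq : p < q) (hq : 1 ≤ q) {s : (Fin d → ℝ) → ℝ}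
    (hs : AEStronglyMeasurable s (cubeMeasure d)) {P : ℕ → (Fin d → ℝ) → ℝ}
    (hP : ∀ j, P j ∈ piecewisePoly r (anisotropicGrid σ j))
    (hlim : Filter.Tendsto (fun j => eLpNorm (s - P j) p (cubeMeasure d)) Filter.atTop (nhds 0))
    (J L : ℕ) (v : ℕ → ℝ) (n : ℕ → ℕ)
    (hL : ∀ i ≥ L, ∀ x ∈ cube d, ‖(P (J + i + 1) - P (J + i)) x‖ₑ ≤ ENNReal.ofReal (v i))
    (hn : ∀ i, ∀ S : Finset (Fin d → ℕ), (∀ c ∈ S, ∃ x ∈ cube d, gridIndex σ (J + i) x = c ∧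
      ENNReal.ofReal (v i) ≤ ‖(P (J + i + 1) - P (J + i)) x‖ₑ) → S.card ≤ n i)
    {E : ℝ≥0∞} (hE : ∀ N, ∑ i ∈ Finset.range N,
      ENNReal.ofReal (v i) ^ (1 - p.toReal / q.toReal) *
        eLpNorm (P (J + i + 1) - P (J + i)) p (cubeMeasure d) ^ (p.toReal / q.toReal) ≤ E) :
    ∃ m : Finpartition (cube d), (∀ K ∈ m.parts, IsDyadicRectangle K) ∧
      m.parts.card ≤ (gridPositions σ J).card + 2 ^ d * ∑ i ∈ Finset.range L, (i + 1) * n i ∧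
      approxError q s (piecewisePoly r (m.parts : Set (Set (Fin d → ℝ)))) ≤ E := by
  classical
  let Δ : ℕ → (Fin d → ℝ) → ℝ := fun i => P (J + i + 1) - P (J + i)
  let κ : ℕ → (Fin d → ℝ) → (Fin d → ℕ) := fun i => gridIndex σ (J + i)
  let M : ℕ → Set (Fin d → ℝ) := fun i => {x ∈ cube d | ENNReal.ofReal (v i) < ‖Δ i x‖ₑ}
  have hM : ∀ i ≥ L, M i = ∅ := fun i hi =>
    Set.eq_empty_of_forall_notMem fun x hx => (hL i hi x hx.1).not_gt hx.2
  have hκ : ∀ i j, i ≤ j → ∀ x y, κ j x = κ j y → κ i x = κ i y := fun i j hij x y h =>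
    gridIndex_congr_of_le hd hσ (Nat.add_le_add_left hij J) h
  let ℓ : (Fin d → ℝ) → ℕ := stopLevel κ M
  have hℓ : ∀ x y, gridIndex σ (J + ℓ x) y = gridIndex σ (J + ℓ x) x → ℓ y = ℓ x :=
    fun x y h => stopLevel_eq_of_eq hM hκ h
  let N : ℕ → Finset (Fin d → ℕ) := fun i =>
    (gridPositions σ (J + i)).filter fun c => ∃ x ∈ M i, κ i x = c
  have hNcard : ∀ i, (N i).card ≤ n i := fun i => hn i _ fun c hc => by
    obtain ⟨-, x, hx, hxc⟩ := Finset.mem_filter.1 hc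
    exact ⟨x, hx.1, hxc, hx.2.le⟩
  obtain ⟨T, hT, hTcard⟩ := exists_finset_stopLevel_card_le (κ := κ) (M := M) (Y := cube d)
    (V := fun i => gridPositions σ (J + i)) (N := N) (B := 2 ^ d) hM hκ
    (fun i x hx => gridIndex_mem_gridPositions hx _)
    (fun i x hx => Finset.mem_filter.2 ⟨gridIndex_mem_gridPositions hx.1 _, x, hx, rfl⟩)
    (fun j x S hS => card_image_gridIndex_succ_le hd hσ (J + j) x S hS)
  obtain ⟨m, hm, hmcard⟩ := exists_finpartition_gridCell J ℓ hℓ T hT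
  have hmdyad : ∀ K ∈ m.parts, IsDyadicRectangle K := by
    intro K hK
    obtain ⟨x, hx, rfl⟩ := hm K hK
    exact isDyadicRectangle_gridCell hx _
  refine ⟨m, hmdyad, ?_, ?_⟩
  · refine hmcard.trans (hTcard.trans ?_)
    simp only [add_zero]
    gcongr with i _
    exact hNcard i
  let A : (Fin d → ℝ) → ℝ := fun x => P (J + ℓ x) x
  have hA : A ∈ piecewisePoly r (m.parts : Set (Set (Fin d → ℝ))) := by
    intro K hK
    obtain ⟨x, hx, rfl⟩ := hm K hK
    obtain ⟨Q, hQ, hQP⟩ := hP _ _ (gridCell_mem_anisotropicGrid hx (J + ℓ x))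
    refine ⟨Q, hQ, fun y hy => ?_⟩
    simp only [A, hℓ x y (gridIndex_eq_of_mem_gridCell hy)]
    exact hQP y hy
  have hAm : AEStronglyMeasurable A (cubeMeasure d) := by
    refine aestronglyMeasurable_of_mem_piecewisePoly (m.parts.countable_toSet) ?_ ?_ hA
    · intro K hK
      obtain ⟨j, k, -, rfl⟩ := hmdyad K hK
      exact measurableSet_dyadicRectangle _ _
    · intro x hx
      have h1 := m.sup_parts.ge
      rw [Finset.sup_id_eq_sSup, Set.sSup_eq_sUnion] at h1
      exact h1 hx
  have hPm : ∀ j, AEStronglyMeasurable (P j) (cubeMeasure d) := fun j =>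
    aestronglyMeasurable_of_mem_grid (hP j)
  -- truncated increments dominate what is left of the increments after stopping
  let g : ℕ → (Fin d → ℝ) → ℝ := fun i x => min |Δ i x| (max (v i) 0)
  have hg0 : ∀ i x, 0 ≤ g i x := fun i x => le_min (abs_nonneg _) (le_max_right _ _)
  have hgm : ∀ i, AEStronglyMeasurable (g i) (cubeMeasure d) := fun i =>
    (((hPm _).sub (hPm _)).norm).inf aestronglyMeasurable_const
  have htele : ∀ x i, ℓ x ≤ i → x ∈ cube d →
      |P (J + i) x - A x| ≤ ∑ k ∈ Finset.range i, g k x := by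
    intro x i hi hx
    induction i, hi using Nat.le_induction with
    | base =>
      simp only [A, sub_self, abs_zero]
      exact Finset.sum_nonneg fun k _ => hg0 k x
    | succ i hi ih =>
      rw [Finset.sum_range_succ]
      have h1 : P (J + (i + 1)) x - A x = (P (J + i) x - A x) + Δ i x := by
        simp only [Δ, Pi.sub_apply, ← add_assoc]
        ring
      have h2 : x ∉ M i := notMem_of_stopLevel_le hM hi
      have h3 : |Δ i x| ≤ max (v i) 0 := by
        have h4 : ‖Δ i x‖ₑ ≤ ENNReal.ofReal (v i) := not_lt.1 fun h => h2 ⟨hx, h⟩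
        rw [Real.enorm_eq_ofReal_abs, ← ENNReal.toReal_le_toReal ENNReal.ofReal_ne_top
          ENNReal.ofReal_ne_top, ENNReal.toReal_ofReal (abs_nonneg _),
          ENNReal.toReal_ofReal'] at h4
        exact h4
      rw [h1]
      refine (abs_add_le _ _).trans (add_le_add ih (le_min le_rfl h3))
  have hbound : ∀ i ≥ L, eLpNorm (P (J + i) - A) q (cubeMeasure d) ≤ E := by
    intro i hi
    have h1 : eLpNorm (P (J + i) - A) q (cubeMeasure d) ≤
        eLpNorm (∑ k ∈ Finset.range i, g k) q (cubeMeasure d) := by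
      refine eLpNorm_mono_ae ?_
      filter_upwards [ae_restrict_mem (measurableSet_cube d)] with x hx
      have h2 : ℓ x ≤ i := (stopLevel_le (not_isActive_of_eventually_empty hM x)).trans hi
      rw [Finset.sum_apply, Real.norm_eq_abs, Real.norm_eq_abs]
      exact (htele x i h2 hx).trans (le_abs_self _)
    refine h1.trans ((eLpNorm_sum_le (fun k _ => hgm k) hq).trans (le_trans ?_ (hE i)))
    refine Finset.sum_le_sum fun k _ => ?_
    have h3 : ∀ x, ‖g k x‖ₑ ≤ ENNReal.ofReal (v k) := by
      intro x
      rw [Real.enorm_eq_ofReal_abs, abs_of_nonneg (hg0 k x)]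
      refine (ENNReal.ofReal_le_ofReal (min_le_right _ _)).trans ?_
      rw [ENNReal.ofReal_max]
      simp
    refine (eLpNorm_le_rpow_mul_eLpNorm_rpow hp hpq ENNReal.ofReal_ne_top h3).trans ?_
    gcongr
    refine eLpNorm_mono fun x => ?_
    rw [Real.norm_eq_abs, abs_of_nonneg (hg0 k x)]
    exact min_le_left _ _
  refine (approxError_le hA).trans ?_
  refine eLpNorm_le_of_tendsto_eLpNorm (p := p) hp (f := fun i => P (J + i) - A)
    (fun i => (hPm _).sub hAm) (hs.sub hAm) ?_
    (Filter.eventually_atTop.2 ⟨L, hbound⟩)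
  have h1 : ∀ i, eLpNorm ((P (J + i) - A) - (s - A)) p (cubeMeasure d)
      = eLpNorm (s - P (i + J)) p (cubeMeasure d) := by
    intro i
    rw [sub_sub_sub_cancel_right, ← eLpNorm_neg, neg_sub, add_comm]
  simp only [h1]
  exact hlim.comp (Filter.tendsto_add_atTop_nat J)

lemma sum_succ_mul_geometric_le {θ : ℝ} (h0 : 0 < θ) (h1 : θ < 1) (L : ℕ) :
    ∑ i ∈ Finset.range L, ((i : ℝ) + 1) * ((1 - θ) ^ 2 * θ ^ i) ≤ 1 := by
  have key : ∑ i ∈ Finset.range L, ((i : ℝ) + 1) * ((1 - θ) ^ 2 * θ ^ i)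
      = 1 - θ ^ L * (1 + L * (1 - θ)) := by
    induction L with
    | zero => simp
    | succ L ih =>
      rw [Finset.sum_range_succ, ih]
      push_cast
      ring
  rw [key]
  have : 0 ≤ θ ^ L * (1 + L * (1 - θ)) := by
    have := sub_pos.2 h1
    positivity
  linarith

/-- The adaptive rate for `p < q`. The thresholds are `E i * (D * 2^(i(β + τ)))^(1/p)`, where `E i`
bounds the `L_p` norm of the `i`-th increment. The choice of `τ` makes the number of refined cells
decay like `2^(-τ i)`, while the errors still decay like `2^(-η i)`. -/
lemma exists_finpartition_approxError_le (hd : 0 < d) (hσ : ∀ l, 0 < σ l) (r : Fin d → ℕ)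
    {p q : ℝ≥0∞} (hp : p ≠ 0) (hpq : p < q) (hq : 1 ≤ q)
    (hcond : gridRate σ * (1 / p.toReal - 1 / q.toReal) < minSmoothness σ) :
    ∃ C : ℝ, 0 < C ∧ ∀ s : (Fin d → ℝ) → ℝ, AEStronglyMeasurable s (cubeMeasure d) →
      ∀ R : ℝ, 0 < R →
      (∀ j : ℕ, gridError r σ p j s ≤ ENNReal.ofReal (R * 2 ^ (-((j : ℝ) * minSmoothness σ)))) →
      ∀ J : ℕ, ∃ m : Finpartition (cube d), (∀ K ∈ m.parts, IsDyadicRectangle K) ∧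
        (m.parts.card : ℝ) ≤ (1 + 2 ^ d) * 2 ^ ((J : ℝ) * gridRate σ) ∧
        approxError q s (piecewisePoly r (m.parts : Set (Set (Fin d → ℝ)))) ≤
          ENNReal.ofReal (C * R * 2 ^ (-((J : ℝ) * minSmoothness σ))) := by
  set a := p.toReal with ha_def
  set b := q.toReal with hb_def
  set μ := minSmoothness σ with hμ_def
  set β := gridRate σ with hβ_def
  have hp_top : p ≠ ∞ := hpq.ne_top
  have ha : 0 < a := ENNReal.toReal_pos hp hp_top
  have hμ : 0 < μ := minSmoothness_pos hd hσ
  have hβ : 0 < β := gridRate_pos hd hσ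
  set γ := 1 / a - 1 / b with hγ_def
  have hab : 0 ≤ 1 - a / b ∧ 0 < γ := by
    rcases eq_or_ne q ∞ with h | h
    · have hb0 : b = 0 := by rw [hb_def, h, ENNReal.toReal_top]
      rw [hγ_def, hb0]
      simp only [div_zero, sub_zero]
      exact ⟨zero_le_one, by positivity⟩
    · have hlt : a < b := (ENNReal.toReal_lt_toReal hp_top h).2 hpq
      have hb : 0 < b := ha.trans hlt
      exact ⟨sub_nonneg.2 ((div_le_one hb).2 hlt.le),
        sub_pos.2 (one_div_lt_one_div_of_lt ha hlt)⟩
  obtain ⟨hab1, hγ⟩ := hab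
  set η := (μ - β * γ) / 2 with hη_def
  have hη : 0 < η := by rw [hη_def]; linarith
  set τ := η / γ with hτ_def
  have hτ : 0 < τ := by positivity
  set θ : ℝ := 2 ^ (-τ) with hθ_def
  have hθ0 : 0 < θ := by positivity
  have hθ1 : θ < 1 := Real.rpow_lt_one_of_one_lt_of_neg one_lt_two (by linarith)
  set ρ : ℝ := 2 ^ (-η) with hρ_def
  have hρ0 : 0 < ρ := by positivity
  have hρ1 : ρ < 1 := Real.rpow_lt_one_of_one_lt_of_neg one_lt_two (by linarith)
  have h1θ : 0 < 1 - θ := sub_pos.2 hθ1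
  have h1ρ : 0 < 1 - ρ := sub_pos.2 hρ1
  have hK := cellConst_pos r a
  set K := cellConst r a with hK_def
  set D : ℝ := K * 2 ^ β / (1 - θ) ^ 2 with hD_def
  have hD : 0 < D := by positivity
  set c : ℝ := p.LpAddConst.toReal * 4 + 1 with hc_def
  have hc : 0 < c := by positivity
  refine ⟨c * D ^ γ * (1 - ρ)⁻¹, by positivity, fun s hs R hR hgrid J => ?_⟩
  -- near-best approximants on all grids
  have hex : ∀ j : ℕ, ∃ t ∈ piecewisePoly r (anisotropicGrid σ j),
      eLpNorm (s - t) p (cubeMeasure d) < ENNReal.ofReal (2 * R * 2 ^ (-((j : ℝ) * μ))) := by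
    intro j
    refine exists_lt_of_approxError_lt ((hgrid j).trans_lt ?_)
    have h2 : (0 : ℝ) < 2 ^ (-((j : ℝ) * μ)) := by positivity
    rw [ENNReal.ofReal_lt_ofReal_iff (by positivity)]
    nlinarith [mul_pos hR h2]
  choose P hP hPs using hex
  let E : ℕ → ℝ := fun i => c * R * 2 ^ (-(((J + i : ℕ) : ℝ) * μ))
  let G : ℕ → ℝ := fun i => D * 2 ^ ((i : ℝ) * (β + τ))
  let v : ℕ → ℝ := fun i => E i * G i ^ (1 / a)
  let w : ℕ → ℝ := fun i => (1 - θ) ^ 2 * θ ^ i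
  let n : ℕ → ℕ := fun i => ⌊(2 : ℝ) ^ ((J : ℝ) * β) * w i⌋₊
  have hEpos : ∀ i, 0 < E i := fun i => by positivity
  have hGpos : ∀ i, 0 < G i := fun i => by positivity
  have hvpos : ∀ i, 0 < v i := fun i => mul_pos (hEpos i) (Real.rpow_pos_of_pos (hGpos i) _)
  have hΔmem : ∀ i, P (J + i + 1) - P (J + i) ∈ piecewisePoly r (anisotropicGrid σ (J + i + 1)) :=
    fun i => sub_mem_piecewisePoly (hP _)
      (piecewisePoly_grid_mono hd hσ (Nat.le_add_right (J + i) 1) (hP (J + i)))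
  have hΔ : ∀ i, eLpNorm (P (J + i + 1) - P (J + i)) p (cubeMeasure d) ≤ ENNReal.ofReal (E i) := by
    intro i
    have hmono : ENNReal.ofReal (2 * R * 2 ^ (-(((J + i + 1 : ℕ) : ℝ) * μ))) ≤
        ENNReal.ofReal (2 * R * 2 ^ (-(((J + i : ℕ) : ℝ) * μ))) := by
      refine ENNReal.ofReal_le_ofReal (mul_le_mul_of_nonneg_left
        (Real.rpow_le_rpow_of_exponent_le one_le_two ?_) (by positivity))
      push_cast
      nlinarith
    refine (eLpNorm_sub_le_of_approx hs (aestronglyMeasurable_of_mem_grid (hP _))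
      (aestronglyMeasurable_of_mem_grid (hP _)) ((hPs _).le.trans hmono) (hPs _).le).trans ?_
    rw [← ENNReal.ofReal_add (by positivity) (by positivity),
      ← ENNReal.ofReal_toReal p.LpAddConst_lt_top.ne, ← ENNReal.ofReal_mul (by positivity)]
    refine ENNReal.ofReal_le_ofReal ?_
    have h2 : (0 : ℝ) < 2 ^ (-(((J + i : ℕ) : ℝ) * μ)) := by positivity
    have h3 := mul_pos hR h2
    simp only [E, hc_def]
    nlinarith
  -- the volume factor in the weak-type bound, in terms of `G`
  have hKG : ∀ i : ℕ, K * (2 : ℝ) ^ (((J + i + 1 : ℕ) : ℝ) * β) =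
      2 ^ ((J : ℝ) * β) * w i * G i := by
    intro i
    have h1 : θ ^ i = 2 ^ (-((i : ℝ) * τ)) := by
      rw [hθ_def, ← Real.rpow_natCast, ← Real.rpow_mul zero_le_two]
      congr 1
      ring
    have h2 : (((J + i + 1 : ℕ) : ℝ) * β) =
        (J : ℝ) * β + β + -((i : ℝ) * τ) + (i : ℝ) * (β + τ) := by
      push_cast
      ring
    simp only [w, G, hD_def]
    rw [h1, h2, Real.rpow_add two_pos, Real.rpow_add two_pos, Real.rpow_add two_pos]
    field_simp
  have hn : ∀ i, ∀ S : Finset (Fin d → ℕ), (∀ c ∈ S, ∃ x ∈ cube d, gridIndex σ (J + i) x = c ∧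
      ENNReal.ofReal (v i) ≤ ‖(P (J + i + 1) - P (J + i)) x‖ₑ) → S.card ≤ n i := by
    intro i S hS
    refine Nat.le_floor ?_
    have h1 := card_mul_rpow_le_eLpNorm_rpow hd hσ (Nat.le_add_right (J + i) 1) (hΔmem i) hp hp_top
      (ENNReal.ofReal (v i)) S hS
    have h2 : (S.card : ℝ≥0∞) * ENNReal.ofReal (v i) ^ a ≤
        ENNReal.ofReal (K * (2 : ℝ) ^ (((J + i + 1 : ℕ) : ℝ) * β)) * ENNReal.ofReal (E i) ^ a :=
      h1.trans (mul_le_mul_right (ENNReal.rpow_le_rpow (hΔ i) ha.le) _)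
    rw [ENNReal.ofReal_rpow_of_pos (hvpos i), ENNReal.ofReal_rpow_of_pos (hEpos i),
      ← ENNReal.ofReal_natCast, ← ENNReal.ofReal_mul (by positivity),
      ← ENNReal.ofReal_mul (by positivity), ENNReal.ofReal_le_ofReal_iff (by positivity), hKG] at h2
    have h3 : v i ^ a = E i ^ a * G i := by
      simp only [v]
      rw [Real.mul_rpow (hEpos i).le (by positivity), ← Real.rpow_mul (hGpos i).le,
        one_div_mul_cancel ha.ne', Real.rpow_one]
    rw [h3] at h2
    have h4 : 0 < E i ^ a * G i := mul_pos (Real.rpow_pos_of_pos (hEpos i) _) (hGpos i)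
    refine le_of_mul_le_mul_right (h2.trans_eq ?_) h4
    ring
  have hn0 : ∃ L, ∀ i ≥ L, n i = 0 := by
    have hlim : Filter.Tendsto (fun i => (2 : ℝ) ^ ((J : ℝ) * β) * w i) Filter.atTop (nhds 0) := by
      have := ((tendsto_pow_atTop_nhds_zero_of_lt_one hθ0.le hθ1).const_mul ((1 - θ) ^ 2)).const_mul
        ((2 : ℝ) ^ ((J : ℝ) * β))
      simpa using this
    obtain ⟨L, hL⟩ := Filter.eventually_atTop.1 (hlim.eventually (gt_mem_nhds one_pos))
    exact ⟨L, fun i hi => Nat.floor_eq_zero.2 (hL i hi)⟩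
  obtain ⟨L, hL⟩ := hn0
  have hlim : Filter.Tendsto (fun j => eLpNorm (s - P j) p (cubeMeasure d)) Filter.atTop
      (nhds 0) := by
    have h1 : Filter.Tendsto (fun j : ℕ => 2 * R * ((2 : ℝ) ^ (-μ)) ^ j) Filter.atTop (nhds 0) := by
      have := (tendsto_pow_atTop_nhds_zero_of_lt_one (r := (2 : ℝ) ^ (-μ)) (by positivity)
        (Real.rpow_lt_one_of_one_lt_of_neg one_lt_two (by linarith))).const_mul (2 * R)
      simpa using this
    have h2 := ENNReal.tendsto_ofReal h1
    rw [ENNReal.ofReal_zero] at h2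
    refine tendsto_of_tendsto_of_tendsto_of_le_of_le tendsto_const_nhds h2 (fun _ => bot_le)
      fun j => (hPs j).le.trans_eq ?_
    rw [← Real.rpow_natCast, ← Real.rpow_mul zero_le_two]
    congr 3
    ring
  have hE : ∀ N, ∑ i ∈ Finset.range N, ENNReal.ofReal (v i) ^ (1 - a / b) *
      eLpNorm (P (J + i + 1) - P (J + i)) p (cubeMeasure d) ^ (a / b) ≤
      ENNReal.ofReal (c * D ^ γ * (1 - ρ)⁻¹ * R * 2 ^ (-((J : ℝ) * μ))) := by
    intro N
    have hterm : ∀ i ∈ Finset.range N, ENNReal.ofReal (v i) ^ (1 - a / b) *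
        eLpNorm (P (J + i + 1) - P (J + i)) p (cubeMeasure d) ^ (a / b) ≤
        ENNReal.ofReal (c * D ^ γ * R * 2 ^ (-((J : ℝ) * μ)) * ρ ^ i) := by
      intro i _
      have hb : 0 ≤ b := ENNReal.toReal_nonneg
      refine (mul_le_mul_right (ENNReal.rpow_le_rpow (hΔ i) (by positivity)) _).trans_eq ?_
      rw [ENNReal.ofReal_rpow_of_pos (hvpos i), ENNReal.ofReal_rpow_of_pos (hEpos i),
        ← ENNReal.ofReal_mul (Real.rpow_nonneg (hvpos i).le _)]
      congr 1
      have h1 : v i ^ (1 - a / b) * E i ^ (a / b) = E i * G i ^ γ := by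
        have hexp : 1 / a * (1 - a / b) = γ := by
          rw [hγ_def, mul_sub, mul_one, one_div_mul_eq_div, div_div_cancel_left' ha.ne', one_div b]
        simp only [v]
        rw [Real.mul_rpow (hEpos i).le (Real.rpow_nonneg (hGpos i).le _),
          ← Real.rpow_mul (hGpos i).le, hexp, mul_right_comm, ← Real.rpow_add (hEpos i),
          sub_add_cancel, Real.rpow_one]
      have h2 : G i ^ γ = D ^ γ * 2 ^ ((i : ℝ) * (β + τ) * γ) := by
        simp only [G]
        rw [Real.mul_rpow hD.le (by positivity), ← Real.rpow_mul zero_le_two]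
      have h3 : ρ ^ i = 2 ^ (-((i : ℝ) * η)) := by
        rw [hρ_def, ← Real.rpow_natCast, ← Real.rpow_mul zero_le_two]
        congr 1
        ring
      have h4 : -(((J + i : ℕ) : ℝ) * μ) + (i : ℝ) * (β + τ) * γ =
          -((J : ℝ) * μ) + -((i : ℝ) * η) := by
        have h5 : τ * γ = η := div_mul_cancel₀ η hγ.ne'
        have h6 : μ = 2 * η + β * γ := by rw [hη_def]; ring
        push_cast
        linear_combination (i : ℝ) * h5 - (i : ℝ) * h6
      rw [h1, h2, h3]
      simp only [E]
      calc c * R * 2 ^ (-(((J + i : ℕ) : ℝ) * μ)) * (D ^ γ * 2 ^ ((i : ℝ) * (β + τ) * γ))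
          = c * D ^ γ * R * (2 ^ (-(((J + i : ℕ) : ℝ) * μ)) * 2 ^ ((i : ℝ) * (β + τ) * γ)) := by
            ring
        _ = c * D ^ γ * R * (2 ^ (-((J : ℝ) * μ)) * 2 ^ (-((i : ℝ) * η))) := by
            rw [← Real.rpow_add two_pos, h4, Real.rpow_add two_pos]
        _ = _ := by ring
    refine (Finset.sum_le_sum hterm).trans ?_
    rw [← ENNReal.ofReal_sum_of_nonneg fun i _ => by positivity, ← Finset.mul_sum]
    refine ENNReal.ofReal_le_ofReal ?_
    have hgeom : ∑ i ∈ Finset.range N, ρ ^ i ≤ (1 - ρ)⁻¹ := by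
      rw [← tsum_geometric_of_lt_one hρ0.le hρ1]
      exact (summable_geometric_of_lt_one hρ0.le hρ1).sum_le_tsum _ fun i _ => by positivity
    calc c * D ^ γ * R * 2 ^ (-((J : ℝ) * μ)) * ∑ i ∈ Finset.range N, ρ ^ i
        ≤ c * D ^ γ * R * 2 ^ (-((J : ℝ) * μ)) * (1 - ρ)⁻¹ := by gcongr
      _ = _ := by ring
  have hL' : ∀ i ≥ L, ∀ x ∈ cube d,
      ‖(P (J + i + 1) - P (J + i)) x‖ₑ ≤ ENNReal.ofReal (v i) := by
    intro i hi x hx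
    by_contra h
    have h1 := hn i {gridIndex σ (J + i) x} fun c hc =>
      ⟨x, hx, (Finset.mem_singleton.1 hc).symm, (not_le.1 h).le⟩
    rw [hL i hi, Finset.card_singleton] at h1
    exact absurd h1 (by norm_num)
  obtain ⟨m, hm, hcard, herr⟩ := exists_finpartition_of_thresholds hd hσ hp hpq hq hs hP hlim J L v
    n hL' hn hE
  refine ⟨m, hm, ?_, herr⟩
  have h1 : ((gridPositions σ J).card : ℝ) ≤ 2 ^ ((J : ℝ) * β) := by
    rw [card_gridPositions]
    push_cast
    exact prod_two_pow_gridLevel_le hd hσ J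
  have h2 : ∑ i ∈ Finset.range L, ((i : ℝ) + 1) * n i ≤ 2 ^ ((J : ℝ) * β) := by
    calc ∑ i ∈ Finset.range L, ((i : ℝ) + 1) * n i
        ≤ ∑ i ∈ Finset.range L, ((i : ℝ) + 1) * (2 ^ ((J : ℝ) * β) * w i) := by
          refine Finset.sum_le_sum fun i _ => mul_le_mul_of_nonneg_left ?_ (by positivity)
          exact Nat.floor_le (by positivity)
      _ = 2 ^ ((J : ℝ) * β) * ∑ i ∈ Finset.range L, ((i : ℝ) + 1) * w i := by
          rw [Finset.mul_sum]
          exact Finset.sum_congr rfl fun i _ => by ring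
      _ ≤ 2 ^ ((J : ℝ) * β) * 1 := by
          gcongr
          exact sum_succ_mul_geometric_le hθ0 hθ1 L
      _ = _ := mul_one _
  calc (m.parts.card : ℝ)
      ≤ ((gridPositions σ J).card + 2 ^ d * ∑ i ∈ Finset.range L, (i + 1) * n i : ℕ) := by
        exact_mod_cast hcard
    _ = (gridPositions σ J).card + 2 ^ d * ∑ i ∈ Finset.range L, ((i : ℝ) + 1) * n i := by
        push_cast
        ring
    _ ≤ 2 ^ ((J : ℝ) * β) + 2 ^ d * 2 ^ ((J : ℝ) * β) := by gcongr
    _ = _ := by ring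

/-- The cells of the `J`-th grid as a partition of the cube. -/
lemma exists_finpartition_grid (hd : 0 < d) (hσ : ∀ l, 0 < σ l) (r : Fin d → ℕ) (J : ℕ) :
    ∃ m : Finpartition (cube d), (∀ K ∈ m.parts, IsDyadicRectangle K) ∧
      (m.parts.card : ℝ) ≤ 2 ^ ((J : ℝ) * gridRate σ) ∧
      piecewisePoly r (anisotropicGrid σ J) ⊆
        piecewisePoly r (m.parts : Set (Set (Fin d → ℝ))) := by
  classical
  obtain ⟨m, hm, hcard⟩ := exists_finpartition_gridCell (σ := σ) J (fun _ => 0) (fun _ _ _ => rfl)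
    ((gridPositions σ J).image fun c => (0, c))
    fun x hx => Finset.mem_image_of_mem _ (gridIndex_mem_gridPositions hx _)
  refine ⟨m, fun K hK => ?_, ?_, fun t ht K hK => ?_⟩
  · obtain ⟨x, hx, rfl⟩ := hm K hK
    exact isDyadicRectangle_gridCell hx _
  · refine le_trans ?_ (prod_two_pow_gridLevel_le hd hσ J)
    have h := hcard.trans Finset.card_image_le
    rw [card_gridPositions] at h
    exact_mod_cast h
  · obtain ⟨x, hx, rfl⟩ := hm K hK
    exact ht _ (gridCell_mem_anisotropicGrid hx _)

/-! ### The smoothness norms -/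

/-- The norm with third index `∞` is the weakest one. -/
lemma smoothnessNorm_top_le (r : Fin d → ℕ) {p p' : ℝ≥0∞} (hp' : p' ≠ 0) (s : (Fin d → ℝ) → ℝ) :
    smoothnessNorm r σ p ∞ s ≤ smoothnessNorm r σ p p' s := by
  rcases eq_or_ne p' ∞ with rfl | h
  · exact le_rfl
  · have ha := ENNReal.toReal_pos hp' h
    rw [smoothnessNorm, if_pos rfl, smoothnessNorm, if_neg h]
    refine iSup_le fun k => ?_
    set e := (2 : ℝ≥0∞) ^ ((k : ℝ) * minSmoothness σ) * gridError r σ p k s with he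
    calc e = (e ^ p'.toReal) ^ (1 / p'.toReal) := by
          rw [← ENNReal.rpow_mul, mul_one_div_cancel ha.ne', ENNReal.rpow_one]
      _ ≤ _ := by
          refine ENNReal.rpow_le_rpow ?_ (one_div_pos.2 ha).le
          exact ENNReal.le_tsum (f := fun k : ℕ => ((2 : ℝ≥0∞) ^ ((k : ℝ) * minSmoothness σ) *
            gridError r σ p k s) ^ p'.toReal) k

lemma gridError_le (r : Fin d → ℕ) (p : ℝ≥0∞) (s : (Fin d → ℝ) → ℝ) (j : ℕ) :
    gridError r σ p j s ≤
      smoothnessNorm r σ p ∞ s * ENNReal.ofReal (2 ^ (-((j : ℝ) * minSmoothness σ))) := by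
  have h1 : (2 : ℝ≥0∞) ^ ((j : ℝ) * minSmoothness σ) * gridError r σ p j s ≤
      smoothnessNorm r σ p ∞ s := by
    rw [smoothnessNorm, if_pos rfl]
    exact le_iSup (fun k : ℕ => (2 : ℝ≥0∞) ^ ((k : ℝ) * minSmoothness σ) * gridError r σ p k s) j
  have h2 : ENNReal.ofReal (2 ^ (-((j : ℝ) * minSmoothness σ))) =
      (2 : ℝ≥0∞) ^ (-((j : ℝ) * minSmoothness σ)) := by
    rw [← ENNReal.ofReal_rpow_of_pos two_pos]
    simp
  rw [h2]
  calc gridError r σ p j s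
      = 2 ^ ((j : ℝ) * minSmoothness σ) * gridError r σ p j s *
          2 ^ (-((j : ℝ) * minSmoothness σ)) := by
        rw [mul_right_comm, ← ENNReal.rpow_add _ _ two_ne_zero ENNReal.ofNat_ne_top,
          add_neg_cancel, ENNReal.rpow_zero, one_mul]
    _ ≤ _ := by gcongr

lemma approxError_mono {p : ℝ≥0∞} {s : (Fin d → ℝ) → ℝ} {T U : Set ((Fin d → ℝ) → ℝ)}
    (h : T ⊆ U) : approxError p s U ≤ approxError p s T :=
  le_iInf₂ fun _ ht => approxError_le (h ht)

/-- For `q ≤ p` the grid error in `L_q` is at most the one in `L_p`. -/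
lemma approxError_grid_le_gridError {r : Fin d → ℕ} {p q : ℝ≥0∞} (hqp : q ≤ p) {j : ℕ}
    {s : (Fin d → ℝ) → ℝ} (hs : AEStronglyMeasurable s (cubeMeasure d)) :
    approxError q s (piecewisePoly r (anisotropicGrid σ j)) ≤ gridError r σ p j s :=
  le_iInf₂ fun _ ht => (approxError_le ht).trans <|
    eLpNorm_le_eLpNorm_of_exponent_le hqp (hs.sub (aestronglyMeasurable_of_mem_grid ht))

/-- The approximation rate in terms of the level `J`, for both orders of `p` and `q`. -/
lemma exists_finpartition_le_smoothnessNorm (hd : 0 < d) (hσ : ∀ l, 0 < σ l) (r : Fin d → ℕ)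
    {p q : ℝ≥0∞} (hp : p ≠ 0) (hp_top : p ≠ ∞) (hq : 1 ≤ q)
    (hcond : gridRate σ * (1 / p.toReal - 1 / q.toReal) < minSmoothness σ) :
    ∃ C : ℝ, 0 < C ∧ ∀ (s : (Fin d → ℝ) → ℝ) (J : ℕ), ∃ m : Finpartition (cube d),
      (∀ K ∈ m.parts, IsDyadicRectangle K) ∧
      (m.parts.card : ℝ) ≤ (1 + 2 ^ d) * 2 ^ ((J : ℝ) * gridRate σ) ∧
      ∀ R : ℝ, 0 < R → AEStronglyMeasurable s (cubeMeasure d) →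
        smoothnessNorm r σ p ∞ s ≤ ENNReal.ofReal R →
        approxError q s (piecewisePoly r (m.parts : Set (Set (Fin d → ℝ)))) ≤
          ENNReal.ofReal (C * R * 2 ^ (-((J : ℝ) * minSmoothness σ))) := by
  have hgridcard : ∀ J : ℕ, (2 : ℝ) ^ ((J : ℝ) * gridRate σ) ≤
      (1 + 2 ^ d) * 2 ^ ((J : ℝ) * gridRate σ) := fun J =>
    le_mul_of_one_le_left (by positivity) (le_add_of_nonneg_right (by positivity))
  rcases le_or_gt q p with hqp | hpq
  · refine ⟨1, one_pos, fun s J => ?_⟩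
    obtain ⟨m, hm, hcard, hsub⟩ := exists_finpartition_grid hd hσ r J
    refine ⟨m, hm, hcard.trans (hgridcard J), fun R hR hs hN => ?_⟩
    refine (approxError_mono hsub).trans ((approxError_grid_le_gridError hqp hs).trans
      ((gridError_le r p s J).trans ?_))
    rw [one_mul, ENNReal.ofReal_mul hR.le]
    gcongr
  · obtain ⟨C, hC, hmain⟩ := exists_finpartition_approxError_le hd hσ r hp hpq hq hcond
    refine ⟨C, hC, fun s J => ?_⟩
    set N := smoothnessNorm r σ p ∞ s with hN_def
    by_cases hgood : AEStronglyMeasurable s (cubeMeasure d) ∧ N ≠ ∞ ∧ N ≠ 0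
    · -- the partition is built for the exact value of the norm, hence does not depend on `R`
      obtain ⟨hs, hNt, hN0⟩ := hgood
      have hNpos : 0 < N.toReal := ENNReal.toReal_pos hN0 hNt
      obtain ⟨m, hm, hcard, herr⟩ := hmain s hs N.toReal hNpos (fun j => by
        rw [ENNReal.ofReal_mul hNpos.le, ENNReal.ofReal_toReal hNt]
        exact gridError_le r p s j) J
      refine ⟨m, hm, hcard, fun R hR _ hN => herr.trans (ENNReal.ofReal_le_ofReal ?_)⟩
      have hNR : N.toReal ≤ R := ENNReal.toReal_le_of_le_ofReal hR.le hN
      gcongr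
    · obtain ⟨m, hm, hcard, hsub⟩ := exists_finpartition_grid hd hσ r J
      refine ⟨m, hm, hcard.trans (hgridcard J), fun R hR hs hN => ?_⟩
      have hN0 : N = 0 := by
        by_contra hN0
        exact hgood ⟨hs, (hN.trans_lt ENNReal.ofReal_lt_top).ne, hN0⟩
      have h0 : gridError r σ p J s = 0 := by
        have h1 := gridError_le (σ := σ) r p s J
        rw [← hN_def, hN0, zero_mul] at h1
        exact le_antisymm h1 bot_le
      refine (approxError_mono hsub).trans ?_
      rw [approxError_eq_zero_of_approxError_eq_zero hd hσ hp hp_top hs h0]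
      exact bot_le

end DyadicApprox

theorem mainTheorem3 (d : ℕ) (hd : 0 < d) (σ : Fin d → ℝ) (hσ : ∀ l, 0 < σ l)
    (p : ℝ≥0∞) (hp : 0 < p) (hp_top : p < ∞) :
    ∃ C₁ : ℝ, 0 < C₁ ∧
      ∀ r : Fin d → ℕ, (∀ l, σ l < (r l : ℝ) + 1) →
      ∀ q : ℝ≥0∞, 1 ≤ q →
      max ((p⁻¹).toReal - (q⁻¹).toReal) 0 < DyadicApprox.harmonicMean σ / (d : ℝ) →
      ∃ C₂ : ℝ, 0 < C₂ ∧
        ∀ p' : ℝ≥0∞, ((p ≤ 1 ∨ q ≤ p) → p' = ∞) → ((1 < p ∧ p < q) → p' = p) →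
        ∀ (s : (Fin d → ℝ) → ℝ) (k : ℕ),
        ∃ m : Finpartition (DyadicApprox.cube d),
          (∀ K ∈ m.parts, DyadicApprox.IsDyadicRectangle K) ∧
          (m.parts.card : ℝ) ≤ C₁ * (2 : ℝ) ^ (k * d) ∧
          ∀ R : ℝ, 0 < R → s ∈ DyadicApprox.smoothnessClass r σ p p' R →
            DyadicApprox.approxError q s
                (DyadicApprox.piecewisePoly r (m.parts : Set (Set (Fin d → ℝ)))) ≤
              ENNReal.ofReal
                (C₂ * R * (2 : ℝ) ^ (-((k : ℝ) * DyadicApprox.harmonicMean σ))) := by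
  refine ⟨1 + 2 ^ d, by positivity, fun r _ q hq hcond => ?_⟩
  have hμ := DyadicApprox.minSmoothness_pos hd hσ
  have hβ := DyadicApprox.gridRate_pos hd hσ
  have hH := DyadicApprox.harmonicMean_eq hd hσ
  set μ := DyadicApprox.minSmoothness σ with hμ_def
  set β := DyadicApprox.gridRate σ with hβ_def
  have hd' : (0 : ℝ) < d := by exact_mod_cast hd
  have hcond' : β * (1 / p.toReal - 1 / q.toReal) < μ := by
    have h1 := (le_max_left _ _).trans_lt hcond
    rw [hH, ENNReal.toReal_inv, ENNReal.toReal_inv, mul_div_assoc, mul_div_cancel_left₀ _ hd'.ne',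
      lt_div_iff₀' hβ] at h1
    simpa only [one_div] using h1
  obtain ⟨C, hC, hmain⟩ := DyadicApprox.exists_finpartition_le_smoothnessNorm hd hσ r hp.ne'
    hp_top.ne hq hcond'
  refine ⟨C * 2 ^ μ, by positivity, fun p' hp'1 hp'2 s k => ?_⟩
  have hp' : p' ≠ 0 := by
    by_cases h : p ≤ 1 ∨ q ≤ p
    · rw [hp'1 h]
      exact ENNReal.top_ne_zero
    · rw [not_or, not_le, not_le] at h
      rw [hp'2 h]
      exact hp.ne'
  -- the level at which the grid has about `2^(kd)` cells
  set J := ⌊(k : ℝ) * d / β⌋₊ with hJ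
  obtain ⟨m, hm, hcard, herr⟩ := hmain s J
  refine ⟨m, hm, hcard.trans ?_, fun R hR hs => ?_⟩
  · have h1 : (J : ℝ) * β ≤ ((k * d : ℕ) : ℝ) := by
      rw [← le_div_iff₀ hβ]
      push_cast
      exact Nat.floor_le (by positivity)
    rw [← Real.rpow_natCast 2 (k * d)]
    gcongr
    exact one_le_two
  · refine (herr R hR hs.1.1 ((DyadicApprox.smoothnessNorm_top_le r hp' s).trans hs.2)).trans
      (ENNReal.ofReal_le_ofReal ?_)
    have h2 : -((J : ℝ) * μ) ≤ μ + -((k : ℝ) * DyadicApprox.harmonicMean σ) := by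
      have h3 : (k : ℝ) * d / β < J + 1 := Nat.lt_floor_add_one _
      have h4 : (k : ℝ) * DyadicApprox.harmonicMean σ = (k : ℝ) * d / β * μ := by
        rw [hH]
        ring
      rw [h4]
      nlinarith
    calc C * R * 2 ^ (-((J : ℝ) * μ))
        ≤ C * R * 2 ^ (μ + -((k : ℝ) * DyadicApprox.harmonicMean σ)) := by
          gcongr
          exact one_le_two
      _ = _ := by
          rw [Real.rpow_add two_pos]
          ring
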